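/- Let $M$ be the figure eight knot complement with its standard ideal triangulation $\mathcal T$ by two tetrahedra. Its deformation variety $\mathrm{Defor}(M,\mathcal T)\subset\mathbb C^{24}$, with coordinates $u_{ij},v_{ij}$ ($i\neq j\in\{1,2,3,4\}$), is the zero set of the ideal $I_D\subset\mathbb Q[u_{ij},v_{ij}]$ generated by the internal relations $$u_{12}u_{13}-u_{13}+1,\ u_{12}u_{14}-u_{12}+1,\ u_{21}u_{23}-u_{21}+1,\ u_{21}u_{24}-u_{24}+1,$$ $$u_{31}u_{34}-u_{31}+1,\ u_{32}u_{34}-u_{34}+1,\ u_{41}u_{43}-u_{43}+1,\ u_{42}u_{43}-u_{42}+1,$$ by the same eight relations with every $u$ replaced by $v$, and by the polynomials (left side minus right side) of the edge and face equations $$u_{13} u_{14} u_{23} v_{21} v_{24} v_{31} = 1,\quad u_{31} u_{32} u_{41} v_{12} v_{13} v_{42} = 1,$$ $$u_{21} u_{24} u_{34} v_{23} v_{41} v_{43} = 1,\quad u_{12} u_{42} u_{43} v_{14} v_{32} v_{34} = 1,$$ $$u_{21} u_{31} u_{41} v_{21} v_{31} v_{41} = 1,\quad u_{12} u_{32} u_{42}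 v_{13} v_{23} v_{43} = 1,$$ $$u_{13} u_{23} u_{43} v_{12} v_{32} v_{42} = 1,\quad u_{14} u_{24} u_{34} v_{14} v_{24} v_{34} = 1.$$ All coordinates are nonzero on $\mathrm{Defor}(M,\mathcal T)$. The diagonal parts of the holonomies of the two chosen generators of the peripheral group are $\mathrm{diag}(L,1,L^*)$ and $\mathrm{diag}(M,1,M^*)$, where $$L=\frac{u_{12}u_{21}}{u_{34}v_{24}},\quad L^*=\frac{v_{42}}{u_{34}},\quad M=\frac{u_{13}u_{31}v_{14}v_{23}}{v_{31}u_{42}v_{42}u_{24}},\quad M^*=\frac{u_{31}v_{13}u_{13}v_{24}}{u_{42}v_{32}u_{24}v_{41}}.$$ Let $$P_2=-v_{14}^{2} v_{43}^{2} + 2v_{14}^{2} v_{43} + v_{14} v_{43}^{2} + u_{43} v_{43} - v_{14}^{2} - v_{14} v_{43} - v_{43},$$ $$H_2=v_{14}^{5} v_{34}^{2} v_{43}^{4} - 4v_{43}^{3} v_{14}^{5} v_{34}^{2} - 2v_{14}^{5} v_{34} v_{43}^{4} - 3v_{43}^{4} v_{14}^{4} v_{34}^{2} + 6v_{43}^{2}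 v_{14}^{5} v_{34}^{2} + 8v_{14}^{5} v_{34} v_{43}^{3} + v_{14}^{5} v_{43}^{4} + 9v_{43}^{3} v_{14}^{4} v_{34}^{2} + 5v_{14}^{4} v_{34} v_{43}^{4} + 3v_{14}^{3} v_{34}^{2} v_{43}^{4} - v_{14}^{3} v_{34} v_{43}^{5} - 4v_{14}^{5} v_{34}^{2} v_{43} - 12v_{14}^{5} v_{34} v_{43}^{2} - 4v_{14}^{5} v_{43}^{3} - 9v_{34}^{2} v_{14}^{4} v_{43}^{2} - 15v_{34} v_{43}^{3} v_{14}^{4} - 2v_{14}^{4} v_{43}^{4} - 5v_{14}^{3} v_{34}^{2} v_{43}^{3} - v_{14}^{3} v_{43}^{4} v_{34} - v_{14}^{2} v_{34}^{2} v_{43}^{4} + 3v_{14}^{2} v_{43}^{5} v_{34} + v_{34}^{2} v_{14}^{5} + 8v_{14}^{5} v_{34} v_{43} + 6v_{14}^{5} v_{43}^{2} + 3v_{34}^{2} v_{14}^{4} v_{43} + 15v_{14}^{4} v_{34} v_{43}^{2} + 6v_{14}^{4} v_{43}^{3} + v_{14}^{3} v_{34}^{2} v_{43}^{2} + 2v_{43}^{3}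 v_{14}^{3} v_{34} + v_{14}^{3} v_{43}^{4} - v_{14}^{2} v_{34}^{2} v_{43}^{3} - 7v_{43}^{4} v_{14}^{2} v_{34} - 3v_{14} v_{34} v_{43}^{5} - 2v_{14}^{5} v_{34} - 4v_{14}^{5} v_{43} - 5v_{43} v_{14}^{4} v_{34} - 6v_{14}^{4} v_{43}^{2} + v_{14}^{3} v_{34}^{2} v_{43} + 3v_{34} v_{14}^{3} v_{43}^{2} + 2v_{14}^{2} v_{34}^{2} v_{43}^{2} + 10v_{14}^{2} v_{34} v_{43}^{3} + v_{14} v_{34}^{2} v_{43}^{3} + 7v_{14} v_{34} v_{43}^{4} + v_{34} v_{43}^{5} + v_{14}^{5} + 2v_{14}^{4} v_{43} - 3v_{14}^{3} v_{34} v_{43} - 3v_{14}^{3} v_{43}^{2} - 6v_{14}^{2} v_{34} v_{43}^{2} - 2v_{14}^{2} v_{43}^{3} - 6v_{14} v_{34} v_{43}^{3} - 2v_{34} v_{43}^{4} + 2v_{14}^{3} v_{43} + 2v_{14}^{2} v_{43}^{2} + v_{34} v_{43}^{3} + v_{14} v_{43}^{2},$$ $$Q_3=v_{14}^{2}v_{34}(v_{34}-1)u_{43}-v_{14}v_{34}+1,$$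 $$H_3=v_{14}^{5} v_{34}^{3} v_{43}^{2} - v_{14}^{5} v_{34}^{3} v_{43} + v_{14}^{4} v_{34}^{5} + v_{34}^{4} v_{43} v_{14}^{4} - 2v_{14}^{4} v_{34}^{3} v_{43}^{2} - 3v_{34}^{4} v_{14}^{4} - v_{34}^{2} v_{14}^{4} v_{43}^{2} - v_{34}^{4} v_{43} v_{14}^{3} + v_{14}^{3} v_{34}^{3} v_{43}^{2} + 3v_{14}^{4} v_{34}^{3} + 2v_{34}^{2} v_{14}^{4} v_{43} - 2v_{14}^{3} v_{34}^{4} + 2v_{14}^{3} v_{34}^{2} v_{43}^{2} - v_{14}^{4} v_{34}^{2} + 4v_{14}^{3} v_{34}^{3} - 2v_{14}^{3} v_{34}^{2} v_{43} + v_{14}^{2} v_{34}^{3} v_{43} - v_{14}^{2} v_{34}^{2} v_{43}^{2} - 2v_{14}^{3} v_{34}^{2} + 3v_{14}^{2} v_{34}^{3} + v_{14}^{2} v_{34}^{2} v_{43} - 5v_{14}^{2} v_{34}^{2} - v_{14}^{2} v_{34} v_{43} - v_{14} v_{34}^{2} v_{43} + 2v_{14}^{2} v_{34} - 2v_{14}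 v_{34}^{2} + v_{14} v_{34} v_{43} + 2v_{14} v_{34} + v_{34} - 1.$$ The components $D_2$ and $D_3$ of $\mathrm{Defor}(M,\mathcal T)$ are the zero sets in $\mathbb C^{24}$ of the ideals $I_2=I_D+\langle P_2,H_2\rangle$ and $I_3=I_D+\langle Q_3,H_3\rangle$ of $\mathbb Q[u_{ij},v_{ij}]$. Let $\mathcal L$ be the ideal of $\mathbb Q[u_{ij},v_{ij},L,L^*,M,M^*]$ generated by $$u_{34}v_{24}L-u_{12}u_{21},\quad v_{31}u_{42}v_{42}u_{24}M-u_{13}u_{31}v_{14}v_{23},\quad u_{34}L^*-v_{42},\quad u_{42}v_{32}u_{24}v_{41}M^*-u_{31}v_{13}u_{13}v_{24}.$$ Then (the ideals $I_2$, $I_3$ being extended to $\mathbb Q[u_{ij},v_{ij},L,L^*,M,M^*]$): 1. $(I_2+\mathcal L)\cap\mathbb Q[L,L^*,M,M^*]=\langle L^3-M,\ L^{*3}-M^*\rangle$, and at every point of $D_2$ one has $L^3=M$ and $L^{*3}=M^*$. 2. $(I_3+\mathcal L)\cap\mathbb Q[L,L^*,M,M^*]=\langle L^3M-1,\ L^{*3}M^*-1\rangle$,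 and at every point of $D_3$ one has $L^3M=1$ and $L^{*3}M^*=1$. -/

import Mathlib

namespace FigureEight

/-- The twelve oriented-edge coordinates `u_ij` of the first tetrahedron and the twelve
coordinates `v_ij` of the second one, for the standard two-tetrahedra ideal triangulation of the
figure eight knot complement. -/
inductive EdgeVar : Type
  | u12 | u13 | u14 | u21 | u23 | u24
  | u31 | u32 | u34 | u41 | u42 | u43
  | v12 | v13 | v14 | v21 | v23 | v24
  | v31 | v32 | v34 | v41 | v42 | v43
  deriving DecidableEq

/-- The peripheral eigenvalue coordinates `L`, `L*`, `M`, `M*`. -/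
inductive PeriphVar : Type
  | L | Ls | M | Ms
  deriving DecidableEq

section Ideals

open MvPolynomial

/-- Internal (cross-ratio) relations of the first tetrahedron. -/
noncomputable def crossRatioU : Set (MvPolynomial EdgeVar ℚ) :=
  { X .u12 * X .u13 - X .u13 + 1,
    X .u12 * X .u14 - X .u12 + 1,
    X .u21 * X .u23 - X .u21 + 1,
    X .u21 * X .u24 - X .u24 + 1,
    X .u31 * X .u34 - X .u31 + 1,
    X .u32 * X .u34 - X .u34 + 1,
    X .u41 * X .u43 - X .u43 + 1,
    X .u42 * X .u43 - X .u42 + 1 }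

/-- Internal (cross-ratio) relations of the second tetrahedron. -/
noncomputable def crossRatioV : Set (MvPolynomial EdgeVar ℚ) :=
  { X .v12 * X .v13 - X .v13 + 1,
    X .v12 * X .v14 - X .v12 + 1,
    X .v21 * X .v23 - X .v21 + 1,
    X .v21 * X .v24 - X .v24 + 1,
    X .v31 * X .v34 - X .v31 + 1,
    X .v32 * X .v34 - X .v34 + 1,
    X .v41 * X .v43 - X .v43 + 1,
    X .v42 * X .v43 - X .v42 + 1 }

/-- Gluing relations around the two edges of the triangulation (two relations for each). -/
noncomputable def edgeRelations : Set (MvPolynomial EdgeVar ℚ) :=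
  { X .u13 * X .u14 * X .u23 * X .v21 * X .v24 * X .v31 - 1,
    X .u31 * X .u32 * X .u41 * X .v12 * X .v13 * X .v42 - 1,
    X .u21 * X .u24 * X .u34 * X .v23 * X .v41 * X .v43 - 1,
    X .u12 * X .u42 * X .u43 * X .v14 * X .v32 * X .v34 - 1 }

/-- Gluing relations for the four faces of the triangulation. -/
noncomputable def faceRelations : Set (MvPolynomial EdgeVar ℚ) :=
  { X .u21 * X .u31 * X .u41 * X .v21 * X .v31 * X .v41 - 1,
    X .u12 * X .u32 * X .u42 * X .v13 * X .v23 * X .v43 - 1,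
    X .u13 * X .u23 * X .u43 * X .v12 * X .v32 * X .v42 - 1,
    X .u14 * X .u24 * X .u34 * X .v14 * X .v24 * X .v34 - 1 }

/-- The ideal of `ℚ[u_ij, v_ij]` generated by the internal and the gluing relations. -/
noncomputable def deforIdeal : Ideal (MvPolynomial EdgeVar ℚ) :=
  Ideal.span (edgeRelations ∪ faceRelations ∪ (crossRatioU ∪ crossRatioV))

/-- The deformation variety, a subset of `ℂ ^ 24`. -/
noncomputable def Defor : Set (EdgeVar → ℂ) := zeroLocus ℂ deforIdeal

/-- The first factor cutting out the second component. It is affine in `u43`, which it expresses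
on that component as a function of `v14` and `v43`. -/
def P2 {R : Type*} [CommRing R] (v14 u43 v43 : R) : R :=
  -v14 ^ 2 * v43 ^ 2 + 2 * v14 ^ 2 * v43 + v14 * v43 ^ 2 + u43 * v43 - v14 ^ 2 - v14 * v43 - v43

/-- The irreducible equation of the projection of the second component to the coordinates
`(v14, v34, v43)`. -/
def H2 {R : Type*} [CommRing R] (v14 v34 v43 : R) : R :=
  v14 ^ 5 * v34 ^ 2 * v43 ^ 4 - 4 * v43 ^ 3 * v14 ^ 5 * v34 ^ 2 - 2 * v14 ^ 5 * v34 * v43 ^ 4 -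
    3 * v43 ^ 4 * v14 ^ 4 * v34 ^ 2 + 6 * v43 ^ 2 * v14 ^ 5 * v34 ^ 2 + 8 * v14 ^ 5 * v34 * v43
    ^ 3 + v14 ^ 5 * v43 ^ 4 + 9 * v43 ^ 3 * v14 ^ 4 * v34 ^ 2 + 5 * v14 ^ 4 * v34 * v43 ^ 4 + 3
    * v14 ^ 3 * v34 ^ 2 * v43 ^ 4 - v14 ^ 3 * v34 * v43 ^ 5 - 4 * v14 ^ 5 * v34 ^ 2 * v43 - 12 *
    v14 ^ 5 * v34 * v43 ^ 2 - 4 * v14 ^ 5 * v43 ^ 3 - 9 * v34 ^ 2 * v14 ^ 4 * v43 ^ 2 - 15 * v34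
    * v43 ^ 3 * v14 ^ 4 - 2 * v14 ^ 4 * v43 ^ 4 - 5 * v14 ^ 3 * v34 ^ 2 * v43 ^ 3 - v14 ^ 3 *
    v43 ^ 4 * v34 - v14 ^ 2 * v34 ^ 2 * v43 ^ 4 + 3 * v14 ^ 2 * v43 ^ 5 * v34 + v34 ^ 2 * v14 ^
    5 + 8 * v14 ^ 5 * v34 * v43 + 6 * v14 ^ 5 * v43 ^ 2 + 3 * v34 ^ 2 * v14 ^ 4 * v43 + 15 * v14
    ^ 4 * v34 * v43 ^ 2 + 6 * v14 ^ 4 * v43 ^ 3 + v14 ^ 3 * v34 ^ 2 * v43 ^ 2 + 2 * v43 ^ 3 *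
    v14 ^ 3 * v34 + v14 ^ 3 * v43 ^ 4 - v14 ^ 2 * v34 ^ 2 * v43 ^ 3 - 7 * v43 ^ 4 * v14 ^ 2 *
    v34 - 3 * v14 * v34 * v43 ^ 5 - 2 * v14 ^ 5 * v34 - 4 * v14 ^ 5 * v43 - 5 * v43 * v14 ^ 4 *
    v34 - 6 * v14 ^ 4 * v43 ^ 2 + v14 ^ 3 * v34 ^ 2 * v43 + 3 * v34 * v14 ^ 3 * v43 ^ 2 + 2 *
    v14 ^ 2 * v34 ^ 2 * v43 ^ 2 + 10 * v14 ^ 2 * v34 * v43 ^ 3 + v14 * v34 ^ 2 * v43 ^ 3 + 7 *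
    v14 * v34 * v43 ^ 4 + v34 * v43 ^ 5 + v14 ^ 5 + 2 * v14 ^ 4 * v43 - 3 * v14 ^ 3 * v34 * v43
    - 3 * v14 ^ 3 * v43 ^ 2 - 6 * v14 ^ 2 * v34 * v43 ^ 2 - 2 * v14 ^ 2 * v43 ^ 3 - 6 * v14 *
    v34 * v43 ^ 3 - 2 * v34 * v43 ^ 4 + 2 * v14 ^ 3 * v43 + 2 * v14 ^ 2 * v43 ^ 2 + v34 * v43 ^
    3 + v14 * v43 ^ 2

/-- The polynomial, affine in `u43`, which expresses `u43` on the third component as a function of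
`v14` and `v34`. -/
def Q3 {R : Type*} [CommRing R] (v14 u43 v34 : R) : R :=
  v14 ^ 2 * v34 * (v34 - 1) * u43 - v14 * v34 + 1

/-- The irreducible equation of the projection of the third component to the coordinates
`(v14, v34, v43)`. -/
def H3 {R : Type*} [CommRing R] (v14 v34 v43 : R) : R :=
  v14 ^ 5 * v34 ^ 3 * v43 ^ 2 - v14 ^ 5 * v34 ^ 3 * v43 + v14 ^ 4 * v34 ^ 5 + v34 ^ 4 * v43 *
    v14 ^ 4 - 2 * v14 ^ 4 * v34 ^ 3 * v43 ^ 2 - 3 * v34 ^ 4 * v14 ^ 4 - v34 ^ 2 * v14 ^ 4 * v43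
    ^ 2 - v34 ^ 4 * v43 * v14 ^ 3 + v14 ^ 3 * v34 ^ 3 * v43 ^ 2 + 3 * v14 ^ 4 * v34 ^ 3 + 2 *
    v34 ^ 2 * v14 ^ 4 * v43 - 2 * v14 ^ 3 * v34 ^ 4 + 2 * v14 ^ 3 * v34 ^ 2 * v43 ^ 2 - v14 ^ 4
    * v34 ^ 2 + 4 * v14 ^ 3 * v34 ^ 3 - 2 * v14 ^ 3 * v34 ^ 2 * v43 + v14 ^ 2 * v34 ^ 3 * v43 -
    v14 ^ 2 * v34 ^ 2 * v43 ^ 2 - 2 * v14 ^ 3 * v34 ^ 2 + 3 * v14 ^ 2 * v34 ^ 3 + v14 ^ 2 * v34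
    ^ 2 * v43 - 5 * v14 ^ 2 * v34 ^ 2 - v14 ^ 2 * v34 * v43 - v14 * v34 ^ 2 * v43 + 2 * v14 ^ 2
    * v34 - 2 * v14 * v34 ^ 2 + v14 * v34 * v43 + 2 * v14 * v34 + v34 - 1

/-- The ideal of the second component. -/
noncomputable def ideal2 : Ideal (MvPolynomial EdgeVar ℚ) :=
  deforIdeal ⊔ Ideal.span {P2 (X .v14) (X .u43) (X .v43), H2 (X .v14) (X .v34) (X .v43)}

/-- The ideal of the third component. -/
noncomputable def ideal3 : Ideal (MvPolynomial EdgeVar ℚ) :=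
  deforIdeal ⊔ Ideal.span {Q3 (X .v14) (X .u43) (X .v34), H3 (X .v14) (X .v34) (X .v43)}

/-- The second component of the deformation variety. -/
noncomputable def D2 : Set (EdgeVar → ℂ) := zeroLocus ℂ ideal2

/-- The third component of the deformation variety. -/
noncomputable def D3 : Set (EdgeVar → ℂ) := zeroLocus ℂ ideal3

/-- An edge coordinate, in the ring with both the edge and the peripheral variables. -/
noncomputable def edge (e : EdgeVar) : MvPolynomial (EdgeVar ⊕ PeriphVar) ℚ := X (Sum.inl e)

/-- A peripheral coordinate, in the ring with both the edge and the peripheral variables. -/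
noncomputable def periph (a : PeriphVar) : MvPolynomial (EdgeVar ⊕ PeriphVar) ℚ := X (Sum.inr a)

/-- The polynomial equations that define `L`, `M`, `L*`, `M*` in terms of the edge coordinates. -/
noncomputable def eigenvalueRelations : Set (MvPolynomial (EdgeVar ⊕ PeriphVar) ℚ) :=
  { edge .u34 * edge .v24 * periph .L - edge .u12 * edge .u21,
    edge .v31 * edge .u42 * edge .v42 * edge .u24 * periph .M
      - edge .u13 * edge .u31 * edge .v14 * edge .v23,
    edge .u34 * periph .Ls - edge .v42,
    edge .u42 * edge .v32 * edge .u24 * edge .v41 * periph .Ms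
      - edge .u31 * edge .v13 * edge .u13 * edge .v24 }

/-- `(I + ⟨eigenvalue relations⟩) ∩ ℚ[L, L*, M, M*]`. -/
noncomputable def eliminationIdeal (I : Ideal (MvPolynomial EdgeVar ℚ)) :
    Ideal (MvPolynomial PeriphVar ℚ) :=
  (I.map (rename Sum.inl : MvPolynomial EdgeVar ℚ →ₐ[ℚ] MvPolynomial (EdgeVar ⊕ PeriphVar) ℚ) ⊔
    Ideal.span eigenvalueRelations).comap
      (rename Sum.inr : MvPolynomial PeriphVar ℚ →ₐ[ℚ] MvPolynomial (EdgeVar ⊕ PeriphVar) ℚ)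

end Ideals

/-- The peripheral eigenvalues at a point. The denominators do not vanish on the deformation
variety, see `Defor_ne_zero`. -/
noncomputable def eigenvalue (z : EdgeVar → ℂ) : PeriphVar → ℂ
  | .L => (z .u12 * z .u21) / (z .u34 * z .v24)
  | .Ls => z .v42 / z .u34
  | .M => (z .u13 * z .u31 * z .v14 * z .v23) / (z .v31 * z .u42 * z .v42 * z .u24)
  | .Ms => (z .u31 * z .v13 * z .u13 * z .v24) / (z .u42 * z .v32 * z .u24 * z .v41)

theorem Defor_ne_zero {z : EdgeVar → ℂ} (hz : z ∈ Defor) (e : EdgeVar) : z e ≠ 0 := by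
  have h : ∀ p ∈ edgeRelations ∪ faceRelations ∪ (crossRatioU ∪ crossRatioV),
      MvPolynomial.aeval z p = 0 := fun p hp => hz p (Ideal.subset_span hp)
  simp only [edgeRelations, faceRelations, crossRatioU, crossRatioV, Set.mem_union,
    Set.mem_insert_iff, Set.mem_singleton_iff, or_imp, forall_and, forall_eq, map_add, map_sub,
    map_mul, map_one, MvPolynomial.aeval_X] at h
  intro h0
  cases e <;> simp [h0] at h

end FigureEight

namespace FigureEight

/-! Each ideal equality splits into two claims: `M` and `M*` are determined by `L` and `L*`, and
nothing relates `L` to `L*`.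

For the first claim the computation takes place at a point with values in an arbitrary commutative
`ℚ`-algebra. The cross-ratio relations reduce the coordinates to eight shape parameters and supply
enough units to clear and cancel denominators without a domain hypothesis. On both components `u23 *
L = (1 - u12) * v14 * v34` (`u_mul_L_eq`, `u_mul_L_eq'`), which removes the factor `1 - u21` from
`M` and `M*`. The equations `H2` and `H3` turn into quadratic equations for `L` (`L_sq_eq`,
`H3_relation`); these determine `u21`, and the cube relations follow. Applied to the universal point
in the quotient ring (`mem_eliminationIdeal_of_forall`), this proves membership in the ideal itself
and not merely in its radical.

For the second claim, `M` and `M*` are, modulo the cube relations, polynomials in `L` and `L*` or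
inverses of such. By `le_of_periphInclusion_mem` it remains to see that the elimination ideal
contains no nonzero polynomial in `L`, `L*`. Points are built with `L* = k` and a second parameter
`t` free (`v14 * v41` on the second component, `v14 * v34` on the third). The shape parameters are
rational in `k`, `t`, `L`, and `L` is a root of a quadratic over `ℚ(k, t)`. Take `k` transcendental
over `ℚ` in an algebraically closed `F`, and `t` transcendental over `F`. If `L` were in `F`, the
quadratic would vanish identically in `t`; setting `t = 1` and `t = k` gives `k ^ 3 = 1`, which is
absurd. So `L` is transcendental over `F`, and `L`, `L*` are algebraically independent. -/

/-- The relations between the shape parameters `a = u12`, `b = u21`, `c = u34`, `d = u43`,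
`x = v14`, `y = v34`, `w = v43`, `B = v21`, together with `v = v23`, `u = u23`, and the peripheral
eigenvalues, after the other edge coordinates are eliminated and denominators are cleared. -/
structure ShapeRelations {R : Type*} [CommRing R] (a b c d x y w B v u L Ls M Ms : R) : Prop where
  isUnit_a : IsUnit a
  isUnit_b : IsUnit b
  isUnit_d : IsUnit d
  isUnit_x : IsUnit x
  isUnit_y : IsUnit y
  isUnit_w : IsUnit w
  isUnit_a_sub : IsUnit (1 - a)
  isUnit_B_sub : IsUnit (1 - B)
  isUnit_c_sub : IsUnit (1 - c)
  isUnit_d_sub : IsUnit (1 - d)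
  isUnit_x_sub : IsUnit (x - 1)
  isUnit_y_sub : IsUnit (y - 1)
  isUnit_w_sub : IsUnit (w - 1)
  eq_a : a * d * x * (y - 1) = 1 - d
  eq_c : c * d * x * (1 - w) = d - 1
  eq_v : a * (c - 1) * (x - 1) * v * w = c * (1 - d) * x
  eq_u : u * d * (y - 1) = (1 - a) * (1 - x) * y * (1 - w)
  eq_bB : b * B * (d - 1) * (w - 1) = (1 - c) * d * (1 - y) * w
  eq_uv : u = a * v * (1 - y)
  v_mul_B : v * B = B - 1
  u_mul_b : u * b = b - 1
  eq_L : c * L = a * b * (1 - B)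
  eq_Ls : c * Ls * (1 - w) = 1
  eq_M : (1 - a) * (1 - c) * M = x * v * (1 - y) * (1 - d) * (1 - w) * (1 - b)
  eq_Ms : (y - 1) * (w - 1) * (1 - c) * x * (1 - a) * (1 - B) * Ms =
    (x - 1) * (1 - d) * y * (1 - b) * w

/-! ### Consequences of the shape relations common to both components. -/

namespace ShapeRelations

variable {R : Type*} [CommRing R] {a b c d x y w B v u L Ls M Ms : R}

theorem isUnit_L (h : ShapeRelations a b c d x y w B v u L Ls M Ms) : IsUnit L := by
  have : IsUnit (c * L) := by
    rw [h.eq_L]; exact (h.isUnit_a.mul h.isUnit_b).mul h.isUnit_B_sub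
  exact isUnit_of_mul_isUnit_right this

theorem v_eq (h : ShapeRelations a b c d x y w B v u L Ls M Ms) :
    (c - 1) * (x - 1) * w * v = c * d * x ^ 2 * (y - 1) := by
  refine h.isUnit_d_sub.mul_left_cancel ?_
  linear_combination (d * x * (y - 1)) * h.eq_v - ((c - 1) * (x - 1) * w * v) * h.eq_a

/-- In `c * L = a * b * (1 - B)`, `v_mul_B` turns `1 - B` into `-v * B`, then `eq_bB` and `eq_a`
remove `b * B` and `a`, leaving a common factor `1 - d` to cancel. -/
theorem L_eq (h : ShapeRelations a b c d x y w B v u L Ls M Ms) :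
    x * c * L * (w - 1) = -v * (1 - c) * w := by
  refine h.isUnit_d_sub.mul_left_cancel ?_
  linear_combination (-x * (d - 1) * (w - 1)) * h.eq_L
    - (x * a * b * (d - 1) * (w - 1)) * h.v_mul_B + (x * a * v) * h.eq_bB
    - (v * (1 - c) * w) * h.eq_a

/-- If `u23 * L = (1 - u12) * v14 * v34` then `M` has a simple form. -/
theorem M_mul_L (h : ShapeRelations a b c d x y w B v u L Ls M Ms)
    (hu : u * L = (1 - a) * (x * y)) :
    (1 - c) * M * L = -x ^ 2 * y * v * (1 - y) * (1 - d) * (1 - w) * b := by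
  refine h.isUnit_a_sub.mul_left_cancel ?_
  linear_combination L * h.eq_M + (x * v * (1 - y) * (1 - d) * (1 - w)) *
    (L * h.u_mul_b - b * hu)

/-- One factor `L` converts `1 - b` through `hu` and `u * b = b - 1`; the other arises when `a * b *
(1 - B)` is replaced by `c * L`. -/
theorem Ms_mul_L_sq (h : ShapeRelations a b c d x y w B v u L Ls M Ms)
    (hu : u * L = (1 - a) * (x * y)) :
    (y - 1) * (w - 1) * (1 - c) * c * L ^ 2 * Ms = (x - 1) * (d - 1) * y ^ 2 * w * a * b ^ 2 := by
  refine (h.isUnit_a_sub.mul h.isUnit_x).mul_left_cancel ?_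
  linear_combination (a * b * L) * h.eq_Ms
    + ((y - 1) * (w - 1) * (1 - c) * x * (1 - a) * L * Ms) * h.eq_L
    + (a * b * (x - 1) * (1 - d) * y * w) * (L * h.u_mul_b - b * hu)


/-! ### Second component: everything in terms of `t = x * (w - 1) / w`. -/

section SecondComponent

variable {t : R}

/-- `P2` equals `w * (d - 1) - T ^ 2 + w * T` with `T = x * (w - 1)`, and `T = t * w`. -/
theorem d_sub_one_eq (h : ShapeRelations a b c d x y w B v u L Ls M Ms)
    (ht : t * w = x * (w - 1)) (hP : P2 x d w = 0) : d - 1 = w * t * (t - 1) := by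
  refine h.isUnit_w.mul_left_cancel ?_
  rw [P2] at hP
  linear_combination hP - (t * w + x * (w - 1) - w) * ht

theorem isUnit_of_mul_eq (h : ShapeRelations a b c d x y w B v u L Ls M Ms)
    (ht : t * w = x * (w - 1)) : IsUnit t := by
  have : IsUnit (t * w) := ht ▸ h.isUnit_x.mul h.isUnit_w_sub
  exact isUnit_of_mul_isUnit_left this

theorem isUnit_sub_one (h : ShapeRelations a b c d x y w B v u L Ls M Ms)
    (ht : t * w = x * (w - 1)) (hP : P2 x d w = 0) : IsUnit (t - 1) := by
  have : IsUnit (w * t * (t - 1)) := by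
    rw [← h.d_sub_one_eq ht hP, ← neg_sub]; exact h.isUnit_d_sub.neg
  exact isUnit_of_mul_isUnit_right this

theorem c_mul_d_eq (h : ShapeRelations a b c d x y w B v u L Ls M Ms)
    (ht : t * w = x * (w - 1)) (hP : P2 x d w = 0) : c * d = 1 - t := by
  refine (h.isUnit_w.mul (h.isUnit_of_mul_eq ht)).mul_left_cancel ?_
  linear_combination (c * d) * ht - h.eq_c - h.d_sub_one_eq ht hP

theorem one_sub_c_mul_d_eq (h : ShapeRelations a b c d x y w B v u L Ls M Ms)
    (ht : t * w = x * (w - 1)) (hP : P2 x d w = 0) :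
    (1 - c) * d = t * (w - 1) * (x - 1) := by
  linear_combination h.d_sub_one_eq ht hP - h.c_mul_d_eq ht hP + t * ht

theorem sub_one_mul_L_eq (h : ShapeRelations a b c d x y w B v u L Ls M Ms)
    (ht : t * w = x * (w - 1)) (hP : P2 x d w = 0) :
    (t - 1) * L = v * (w - 1) * (x - 1) := by
  refine ((h.isUnit_of_mul_eq ht).mul h.isUnit_w).mul_left_cancel ?_
  linear_combination (-d) * h.L_eq - (c * d * L) * ht + (w * v) * h.one_sub_c_mul_d_eq ht hP
    + (w * t * L) * h.c_mul_d_eq ht hP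

theorem mul_L_eq (h : ShapeRelations a b c d x y w B v u L Ls M Ms)
    (ht : t * w = x * (w - 1)) (hP : P2 x d w = 0) :
    (w - 1) * (x - 1) * L = x * d * (y - 1) := by
  refine ((h.isUnit_sub_one ht hP).mul h.isUnit_x).mul_left_cancel ?_
  linear_combination (x * (w - 1) * (x - 1)) * h.sub_one_mul_L_eq ht hP - d * h.v_eq
    - (x ^ 2 * d * (y - 1)) * h.c_mul_d_eq ht hP
    + ((x - 1) * w * v) * (-h.one_sub_c_mul_d_eq ht hP) - ((x - 1) ^ 2 * v * (w - 1)) * ht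

theorem L_sq_eq (h : ShapeRelations a b c d x y w B v u L Ls M Ms)
    (ht : t * w = x * (w - 1)) (hP : P2 x d w = 0) (hH : H2 x y w = 0) :
    L ^ 2 = x * y * (L + w * (t - 1)) := by
  have hq : IsUnit (w * (x - 1) * (w - 1)) :=
    (h.isUnit_w.mul h.isUnit_x_sub).mul h.isUnit_w_sub
  refine (hq.mul hq).mul_left_cancel ?_
  have hp : x * ((x ^ 2 * (w - 1) ^ 2 - x * w * (w - 1) + w) * (y - 1)) =
      w * (x - 1) * (w - 1) * L := by
    rw [P2] at hP
    linear_combination (-w) * h.mul_L_eq ht hP - (x * (y - 1)) * hP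
  -- `H2` is a quadratic form in the two products whose ratio is `L / x` by `hp`; dividing by the
  -- square of the second one gives the quadratic equation for `L`.
  have hH' : H2 x y w = x * ((x ^ 2 * (w - 1) ^ 2 - x * w * (w - 1) + w) * (y - 1)) ^ 2
      - x * y * ((x ^ 2 * (w - 1) ^ 2 - x * w * (w - 1) + w) * (y - 1)) *
        (w * (x - 1) * (w - 1))
      - y * (x * (w - 1) - w) * (w * (x - 1) * (w - 1)) ^ 2 := by
    rw [H2]; ring
  rw [hH'] at hH
  linear_combination x * hH
    - (x * ((x ^ 2 * (w - 1) ^ 2 - x * w * (w - 1) + w) * (y - 1)) + w * (x - 1) * (w - 1) * L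
      - x * y * (w * (x - 1) * (w - 1))) * hp
    - (w * (x - 1) * (w - 1)) ^ 2 * x * y * ht

/-- The product `d * (y - 1)` occurs in both `eq_u` and `mul_L_eq`; eliminating it gives the
identity on which the formulas for `M` and `Ms` rest. -/
theorem u_mul_L_eq (h : ShapeRelations a b c d x y w B v u L Ls M Ms)
    (ht : t * w = x * (w - 1)) (hP : P2 x d w = 0) : u * L = (1 - a) * (x * y) := by
  refine (h.isUnit_w_sub.mul h.isUnit_x_sub).mul_left_cancel ?_
  linear_combination u * h.mul_L_eq ht hP + x * h.eq_u

/-- Multiply `L = b * (L - (1 - a) * x * y)` by `L` and insert `L_sq_eq`: the terms linear in `L`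
cancel except the one with `a * L`, which `ha` evaluates. The square of `t - 1` comes from `(x - 1)
* (w - 1) - t = (t - 1) * (w - 1)`. -/
theorem L_sq_mul_eq (h : ShapeRelations a b c d x y w B v u L Ls M Ms)
    (ht : t * w = x * (w - 1)) (hP : P2 x d w = 0) (hH : H2 x y w = 0) :
    L ^ 2 * (x - 1) = b * (x * y * w * (t - 1) ^ 2) := by
  have ha : a * ((w - 1) * (x - 1) * L) = -(w * t * (t - 1)) := by
    linear_combination a * h.mul_L_eq ht hP + h.eq_a - h.d_sub_one_eq ht hP
  have hb : L = b * (L - (1 - a) * (x * y)) := by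
    linear_combination L * h.u_mul_b - b * h.u_mul_L_eq ht hP
  refine h.isUnit_w_sub.mul_left_cancel ?_
  linear_combination (L * (x - 1) * (w - 1)) * hb + (b * (x - 1) * (w - 1)) * h.L_sq_eq ht hP hH
    + (b * x * y) * ha + (b * x * y * w * (t - 1)) * (-ht)

theorem L_pow_three_eq_M (h : ShapeRelations a b c d x y w B v u L Ls M Ms)
    (ht : t * w = x * (w - 1)) (hP : P2 x d w = 0) (hH : H2 x y w = 0) : L ^ 3 = M := by
  have h1 : M = x * y * w * (t - 1) * b * v * (w - 1) := by
    refine (((h.isUnit_of_mul_eq ht).mul h.isUnit_w_sub).mul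
      (h.isUnit_x_sub.mul h.isUnit_L)).mul_left_cancel ?_
    linear_combination d * h.M_mul_L (h.u_mul_L_eq ht hP)
      - (M * L) * h.one_sub_c_mul_d_eq ht hP
      + (x ^ 2 * y * v * d * (y - 1) * (w - 1) * b) * h.d_sub_one_eq ht hP
      - (x * y * v * (w - 1) * b * w * t * (t - 1)) * h.mul_L_eq ht hP
  refine h.isUnit_x_sub.mul_left_cancel ?_
  linear_combination (-(x - 1)) * h1 + L * h.L_sq_mul_eq ht hP hH
    + (x * y * w * (t - 1) * b) * h.sub_one_mul_L_eq ht hP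

theorem Ls_pow_three_eq_Ms (h : ShapeRelations a b c d x y w B v u L Ls M Ms)
    (ht : t * w = x * (w - 1)) (hP : P2 x d w = 0) (hH : H2 x y w = 0) : Ls ^ 3 = Ms := by
  have ut := h.isUnit_of_mul_eq ht
  have ut1 := h.isUnit_sub_one ht hP
  -- The formula for `Ms` is freed of `a` and `c` in `h1`, of `b` in `h2`, and of `x`, `y` and `L`
  -- in `h3`. What is left is visibly the cube of `h4`.
  have h1 : (y - 1) ^ 2 * (w - 1) ^ 2 * x * L ^ 2 * Ms =
      w ^ 3 * t * (t - 1) * y ^ 2 * b ^ 2 * d := by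
    refine ((h.isUnit_x_sub.mul ut).mul ut1).mul_left_cancel ?_
    have e1 := h.one_sub_c_mul_d_eq ht hP
    have e2 := h.c_mul_d_eq ht hP
    have e3 := h.d_sub_one_eq ht hP
    have e4 := h.Ms_mul_L_sq (h.u_mul_L_eq ht hP)
    linear_combination (-(y - 1) * d ^ 2 * x) * e4
      + ((y - 1) ^ 2 * (w - 1) * x * L ^ 2 * Ms) * (c * d * e1 + t * (w - 1) * (x - 1) * e2)
      - ((x - 1) * (d - 1) * y ^ 2 * w * b ^ 2 * d) * h.eq_a
      + ((x - 1) * y ^ 2 * w * b ^ 2 * d) * (d - 1 + w * t * (t - 1)) * e3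
  have h2 : (y - 1) ^ 2 * (w - 1) ^ 2 * x ^ 3 * (t - 1) ^ 3 * Ms =
      w * t * d * L ^ 2 * (x - 1) ^ 2 := by
    refine (h.isUnit_L.pow 2).mul_left_cancel ?_
    linear_combination (x ^ 2 * (t - 1) ^ 3) * h1
      - (w * t * d) * (L ^ 2 * (x - 1) + b * (x * y * w * (t - 1) ^ 2)) * h.L_sq_mul_eq ht hP hH
  have h3 : ((w - 1) * (t - 1)) ^ 3 * Ms = d ^ 3 := by
    refine (((h.isUnit_y_sub.pow 2).mul (h.isUnit_x.pow 3)).mul h.isUnit_w_sub).mul_left_cancel ?_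
    linear_combination ((w - 1) ^ 2) * h2 + (w * t * d) *
      ((w - 1) * (x - 1) * L + x * d * (y - 1)) * h.mul_L_eq ht hP
      + (x ^ 2 * d ^ 3 * (y - 1) ^ 2) * ht
  have h4 : (w - 1) * (t - 1) * Ls = d := by
    linear_combination d * h.eq_Ls + ((w - 1) * Ls) * h.c_mul_d_eq ht hP
  refine ((h.isUnit_w_sub.mul ut1).pow 3).mul_left_cancel ?_
  rw [h3, ← mul_pow, h4]

end SecondComponent

/-! ### Third component: everything in terms of `p = x * y`, `x`, `w` and `L`. -/

section ThirdComponent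

/-- With `p = x * y` this reads `d = (p - 1) / (p * (p - x))`. Hence `p - x`, `p - 1` and `r = p *
(p - x) - (p - 1)` are the building blocks of `a`, `c`, `d` and `Ls`. -/
theorem mul_d_eq (hQ : Q3 x d y = 0) : x * y * (x * y - x) * d = x * y - 1 := by
  rw [Q3] at hQ; linear_combination hQ

theorem isUnit_mul_sub (h : ShapeRelations a b c d x y w B v u L Ls M Ms) :
    IsUnit (x * y - x) := by
  have := h.isUnit_x.mul h.isUnit_y_sub
  rwa [mul_sub, mul_one] at this

theorem isUnit_mul_sub_one (h : ShapeRelations a b c d x y w B v u L Ls M Ms)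
    (hQ : Q3 x d y = 0) : IsUnit (x * y - 1) := by
  rw [← mul_d_eq hQ]
  exact ((h.isUnit_x.mul h.isUnit_y).mul h.isUnit_mul_sub).mul h.isUnit_d

theorem mul_one_sub_d_eq (hQ : Q3 x d y = 0) :
    x * y * (x * y - x) * (1 - d) = x * y * (x * y - x) - (x * y - 1) := by
  linear_combination -mul_d_eq hQ

theorem isUnit_mul_sub_sub (h : ShapeRelations a b c d x y w B v u L Ls M Ms)
    (hQ : Q3 x d y = 0) : IsUnit (x * y * (x * y - x) - (x * y - 1)) := by
  rw [← mul_one_sub_d_eq hQ]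
  exact ((h.isUnit_x.mul h.isUnit_y).mul h.isUnit_mul_sub).mul h.isUnit_d_sub

theorem a_mul_eq (h : ShapeRelations a b c d x y w B v u L Ls M Ms) (hQ : Q3 x d y = 0) :
    a * (x * y - x) * (x * y - 1) = x * y * (x * y - x) - (x * y - 1) := by
  linear_combination (-a * (x * y - x)) * mul_d_eq hQ + (x * y * (x * y - x)) * h.eq_a
    + mul_one_sub_d_eq hQ

theorem c_mul_eq (h : ShapeRelations a b c d x y w B v u L Ls M Ms) (hQ : Q3 x d y = 0) :
    c * x * (w - 1) * (x * y - 1) = x * y * (x * y - x) - (x * y - 1) := by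
  linear_combination (-c * x * (w - 1)) * mul_d_eq hQ - (x * y * (x * y - x)) * h.eq_c
    + mul_one_sub_d_eq hQ

theorem mul_Ls_eq (h : ShapeRelations a b c d x y w B v u L Ls M Ms) (hQ : Q3 x d y = 0) :
    (x * y * (x * y - x) - (x * y - 1)) * Ls = -(x * (x * y - 1)) := by
  linear_combination (-Ls) * h.c_mul_eq hQ - (x * (x * y - 1)) * h.eq_Ls

/-- `L_eq` and `v_eq` share the product `(1 - c) * w * v`. Eliminating it makes `w` a rational
function of `x`, `y`, `L`. -/
theorem w_sub_one_mul_L_eq (h : ShapeRelations a b c d x y w B v u L Ls M Ms)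
    (hQ : Q3 x d y = 0) : x * y * (x - 1) * (w - 1) * L = x * y - 1 := by
  refine (h.isUnit_mul_sub_sub hQ).mul_left_cancel ?_
  have e : (x * y * (x * y - x) - (x * y - 1)) * L = -v * (1 - c) * (x * y - 1) * w := by
    linear_combination (x * y - 1) * h.L_eq - L * h.c_mul_eq hQ
  linear_combination (x * y * (x - 1) * (w - 1)) * e
    + (x * y * (w - 1) * (x * y - 1)) * h.v_eq
    + (c * x * (x * y - 1) * (w - 1)) * mul_d_eq hQ + (x * y - 1) * h.c_mul_eq hQ

theorem u_mul_L_eq' (h : ShapeRelations a b c d x y w B v u L Ls M Ms)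
    (hQ : Q3 x d y = 0) : u * L = (1 - a) * (x * y) := by
  refine (h.isUnit_mul_sub_one hQ).mul_left_cancel ?_
  linear_combination (-u * L) * mul_d_eq hQ + (x ^ 2 * y * L) * h.eq_u
    + ((1 - a) * (x * y)) * h.w_sub_one_mul_L_eq hQ

theorem H3_relation (h : ShapeRelations a b c d x y w B v u L Ls M Ms)
    (hQ : Q3 x d y = 0) (hH : H3 x y w = 0) :
    L * (x * y * (x * y - x) - (x * y - 1)) *
        ((x * y - x) * (x * y - 1) * L + x * y * (1 - x)) +
      x * (x * y - 1) ^ 2 * ((x * y - 1) * L + 1) = 0 := by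
  refine (h.isUnit_mul_sub_one hQ).mul_left_cancel ?_
  have hL : x * y * (x - 1) * w * L = x * y - 1 + x * y * (x - 1) * L := by
    linear_combination h.w_sub_one_mul_L_eq hQ
  -- `x * H3` is quadratic in `W = x * y * (x - 1) * w`, and `hL` gives `W * L`; multiplying by `L ^
  -- 2` therefore eliminates `w`.
  have hH' : x * H3 x y w = x * (x * y - 1) * (x * y * (x - 1) * w) ^ 2
      + (x * (x * y - 1) ^ 3
          - x * y * (x - 1) * ((x * y) ^ 2 - x * y + 1 - 2 * x + x * (x * y)))
        * (x * y * (x - 1) * w)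
      + (x * y * (x * y - x) - (x * y - 1)) ^ 2 * (x * y - x) := by
    rw [H3]; ring
  rw [hH, mul_zero] at hH'
  linear_combination (-L ^ 2) * hH'
    - (x * (x * y - 1) * (x * y * (x - 1) * w * L + x * y - 1 + x * y * (x - 1) * L)
      + (x * (x * y - 1) ^ 3
          - x * y * (x - 1) * ((x * y) ^ 2 - x * y + 1 - 2 * x + x * (x * y))) * L) * hL

theorem b_mul_eq (h : ShapeRelations a b c d x y w B v u L Ls M Ms) (hQ : Q3 x d y = 0) :
    b * ((x * y - x) * (x * y - 1) * L + x * y * (1 - x)) = (x * y - x) * (x * y - 1) * L := by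
  have hb : L = b * (L - (1 - a) * (x * y)) := by
    linear_combination L * h.u_mul_b - b * h.u_mul_L_eq' hQ
  linear_combination (-(x * y - x) * (x * y - 1)) * hb - (b * x * y) * h.a_mul_eq hQ

theorem one_sub_c_mul_eq (h : ShapeRelations a b c d x y w B v u L Ls M Ms)
    (hQ : Q3 x d y = 0) :
    (1 - c) * (x * (w - 1) * (x * y - 1)) = -(x * y * (x * y - x) - (x * y - 1)
      - x * (w - 1) * (x * y - 1)) := by
  linear_combination -h.c_mul_eq hQ

/-- This expression, called `S` below, is up to sign the numerator of `1 - c`, so it inherits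
invertibility. -/
theorem isUnit_S (h : ShapeRelations a b c d x y w B v u L Ls M Ms)
    (hQ : Q3 x d y = 0) :
    IsUnit (x * y * (x * y - x) - (x * y - 1) - x * (w - 1) * (x * y - 1)) := by
  have := (h.isUnit_c_sub.mul ((h.isUnit_x.mul h.isUnit_w_sub).mul
    (h.isUnit_mul_sub_one hQ))).neg
  rwa [h.one_sub_c_mul_eq hQ, neg_neg] at this

theorem S_mul_eq (h : ShapeRelations a b c d x y w B v u L Ls M Ms) (hQ : Q3 x d y = 0) :
    x * y * (x - 1) * L * (x * y * (x * y - x) - (x * y - 1) - x * (w - 1) * (x * y - 1)) =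
      x * y * (x - 1) * L * (x * y * (x * y - x) - (x * y - 1)) - x * (x * y - 1) ^ 2 := by
  linear_combination (-x * (x * y - 1)) * h.w_sub_one_mul_L_eq hQ

/-- The parameter `u21` in terms of `v14`, `v34`, `v43` and `L` on the third component. -/
theorem b_eq (h : ShapeRelations a b c d x y w B v u L Ls M Ms)
    (hQ : Q3 x d y = 0) (hH : H3 x y w = 0) :
    b * (x ^ 2 * (x * y - 1) ^ 3) = -((x * y - x) * (x * y * (x - 1) * L *
      (x * y * (x * y - x) - (x * y - 1) - x * (w - 1) * (x * y - 1)))) := by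
  rw [h.S_mul_eq hQ]
  have hH3 := h.H3_relation hQ hH
  have hb := h.b_mul_eq hQ
  have hT : x * y * (x - 1) * L * (x * y * (x * y - x) - (x * y - 1)) - x * (x * y - 1) ^ 2 =
      L * (x * y - 1) * (L * (x * y * (x * y - x) - (x * y - 1)) * (x * y - x)
        + x * (x * y - 1) ^ 2) := by
    linear_combination -hH3
  rw [hT]
  -- Another factored form of `H3_relation`: it exhibits the coefficient of `b` in `b_mul_eq` as a
  -- divisor of a unit, so that `b` can be solved for.
  have hkey : x ^ 2 * (x * y - 1) ^ 3 = -((L * (x * y * (x * y - x) - (x * y - 1)) * (x * y - x)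
        + x * (x * y - 1) ^ 2) * ((x * y - x) * (x * y - 1) * L + x * y * (1 - x))) := by
    linear_combination (x * y - x) * hH3
  rw [hkey]
  linear_combination (-(L * (x * y * (x * y - x) - (x * y - 1)) * (x * y - x)
        + x * (x * y - 1) ^ 2)) * hb

/-- Two expressions for `v`, one from `L_eq` (`e`) and one from `u = a * v * (1 - y)` and the value
of `u * L` (`e2`), are compared to eliminate `v`. -/
theorem w_mul_S_eq (h : ShapeRelations a b c d x y w B v u L Ls M Ms)
    (hQ : Q3 x d y = 0) :
    (x * y) ^ 2 * (x - 1) ^ 2 * w *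
        (x * y * (x * y - x) - (x * y - 1) - x * (w - 1) * (x * y - 1)) =
      -((x * y * (x * y - x) - (x * y - 1)) ^ 2 * (x * y - x) * (x * y - 1) * L) := by
  have e : (x * y * (x * y - x) - (x * y - 1)) * L * (x * (w - 1)) = v * w *
      (x * y * (x * y - x) - (x * y - 1) - x * (w - 1) * (x * y - 1)) := by
    linear_combination (x * (w - 1)) * ((x * y - 1) * h.L_eq - L * h.c_mul_eq hQ)
      - (v * w) * h.one_sub_c_mul_eq hQ
  have e1 : (1 - a) * ((x * y - x) * (x * y - 1)) = x - 1 := by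
    linear_combination -h.a_mul_eq hQ
  have e2 : (x * y * (x * y - x) - (x * y - 1)) * v * (1 - y) * L = x * y * (x - 1) := by
    linear_combination (x * y) * e1 + ((x * y - x) * (x * y - 1)) * h.u_mul_L_eq' hQ
      - (L * (x * y - x) * (x * y - 1)) * h.eq_uv - (v * (1 - y) * L) * h.a_mul_eq hQ
  refine h.isUnit_x.mul_left_cancel ?_
  linear_combination (-x ^ 2 * y * (x - 1) * w *
      (x * y * (x * y - x) - (x * y - 1) - x * (w - 1) * (x * y - 1))) * e2
    + (-x * y * (x - 1) * (x * y * (x * y - x) - (x * y - 1)) * L * (x * y - x)) * e * (-1)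
    - (x * (x * y * (x * y - x) - (x * y - 1)) ^ 2 * (x * y - x) * L) *
      h.w_sub_one_mul_L_eq hQ


theorem L_pow_three_mul_M_eq_one (h : ShapeRelations a b c d x y w B v u L Ls M Ms)
    (hQ : Q3 x d y = 0) (hH : H3 x y w = 0) : L ^ 3 * M = 1 := by
  have uS := h.isUnit_S hQ
  have hS := h.one_sub_c_mul_eq hQ
  have hw := h.w_mul_S_eq hQ
  have hb := h.b_eq hQ hH
  have hwL := h.w_sub_one_mul_L_eq hQ
  have hc := h.c_mul_eq hQ
  have hd := mul_one_sub_d_eq hQ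
  have hd' := mul_d_eq hQ
  have hu := h.u_mul_L_eq' hQ
  -- From here on only the relations just collected matter: the identities hold with `r` and `S` as
  -- independent letters.
  obtain ⟨r, hr⟩ : ∃ r, r = x * y * (x * y - x) - (x * y - 1) := ⟨_, rfl⟩
  rw [← hr] at hS hw hb hc hd uS
  obtain ⟨S, hS'⟩ : ∃ S, S = r - x * (w - 1) * (x * y - 1) := ⟨_, rfl⟩
  rw [← hS'] at hS hw hb uS
  have e1 : S * M * L = v * r * (w - 1) * b * (x * (w - 1) * (x * y - 1)) := by
    linear_combination (-(x * (w - 1) * (x * y - 1))) * h.M_mul_L hu + (M * L) * hS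
      + (v * (w - 1) * b * (x * (w - 1) * (x * y - 1))) * hd
  have e2 : v * (y * w * (x - 1) * S) = (x * y - 1) * r := by
    linear_combination (y * (x * (w - 1) * (x * y - 1))) * h.v_eq + (y * v * w * (x - 1)) * hS
      + (x ^ 2 * y * d * (y - 1)) * hc + r * hd'
  refine ((((uS.pow 2).mul h.isUnit_w).mul (h.isUnit_x_sub.pow 3)).mul
    ((h.isUnit_x.mul h.isUnit_y).pow 3)).mul_left_cancel ?_
  linear_combination (L ^ 2 * (y * w * (x - 1) * S) * (x * y) ^ 2 * (x - 1) ^ 2 * x) * e1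
    + (L ^ 2 * r * (w - 1) * b * (x * (w - 1) * (x * y - 1)) * (x * y) ^ 2 * (x - 1) ^ 2 * x) * e2
    + (r ^ 2 * b * x ^ 2 * (x * y - 1) ^ 2) * (x * y * (x - 1) * (w - 1) * L + (x * y - 1)) * hwL
    + (r ^ 2 * (x * y - 1)) * hb - (x * y * (x - 1) * S) * hw

theorem Ls_pow_three_mul_Ms_eq_one (h : ShapeRelations a b c d x y w B v u L Ls M Ms)
    (hQ : Q3 x d y = 0) (hH : H3 x y w = 0) : Ls ^ 3 * Ms = 1 := by
  have uS := h.isUnit_S hQ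
  have ur := h.isUnit_mul_sub_sub hQ
  have up := h.isUnit_mul_sub
  have up1 := h.isUnit_mul_sub_one hQ
  have hS := h.one_sub_c_mul_eq hQ
  have hw := h.w_mul_S_eq hQ
  have hb := h.b_eq hQ hH
  have hwL := h.w_sub_one_mul_L_eq hQ
  have hc := h.c_mul_eq hQ
  have ha := h.a_mul_eq hQ
  have hd := mul_one_sub_d_eq hQ
  have hLs := h.mul_Ls_eq hQ
  have e0 := h.Ms_mul_L_sq (h.u_mul_L_eq' hQ)
  obtain ⟨r, hr⟩ : ∃ r, r = x * y * (x * y - x) - (x * y - 1) := ⟨_, rfl⟩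
  rw [← hr] at hS hw hb hc hd uS ur hLs ha
  obtain ⟨S, hS'⟩ : ∃ S, S = r - x * (w - 1) * (x * y - 1) := ⟨_, rfl⟩
  rw [← hS'] at hS hw hb uS
  -- The formula for `Ms` loses `a`, `c` and `d` in `e1`, `b` and `L` in `e2`, and `w` and `S` in
  -- `e3`; comparison with `r * Ls = -(x * (x * y - 1))` finishes.
  have e1 : (x * y - x) ^ 3 * S * L ^ 2 * Ms =
      (x - 1) * (x * y) * x * w * (w - 1) * (x * y - 1) * b ^ 2 * r := by
    refine ur.mul_left_cancel ?_
    linear_combination (-(x ^ 2 * (w - 1) * (x * y - 1) ^ 2 * x * (x * y - x) ^ 2)) * e0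
      + ((x * y - x) ^ 3 * L ^ 2 * Ms * c * x * (w - 1) * (x * y - 1)) * hS
      - ((x * y - x) ^ 3 * L ^ 2 * Ms * S) * hc
      + ((x - 1) * (x * y) * x * w * (w - 1) * (x * y - 1) * b ^ 2) *
        (a * (x * y - x) * (x * y - 1) * hd + r * ha)
  have e2 : x ^ 3 * (x * y - 1) ^ 5 * (x * y - x) * Ms =
      (x * y) ^ 3 * (x - 1) ^ 3 * r * w * (w - 1) * S := by
    refine ((((up.pow 2).mul uS).mul (h.isUnit_L.pow 2)).mul up1).mul_left_cancel ?_
    linear_combination (x ^ 3 * (x * y - 1) ^ 6) * e1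
      + ((x - 1) * (x * y) * w * (w - 1) * (x * y - 1) * r) *
        (b * (x ^ 2 * (x * y - 1) ^ 3) - ((x * y - x) * (x * y * (x - 1) * L * S))) * hb
  have e3 : x ^ 3 * (x * y - 1) ^ 3 * Ms = -r ^ 3 := by
    refine ((h.isUnit_L.mul (up1.pow 2)).mul up).mul_left_cancel ?_
    linear_combination L * e2 + ((x * y) ^ 2 * (x - 1) ^ 2 * r * w * S) * hwL
      + ((x * y - 1) * r) * hw
  refine (ur.pow 3).mul_left_cancel ?_
  have : (r * Ls) ^ 3 = (-(x * (x * y - 1))) ^ 3 := by rw [hLs]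
  linear_combination Ms * this - e3

end ThirdComponent

end ShapeRelations

/-! ### From edge coordinates to shape relations. -/

/-- The relations say `z' = 1 / (1 - z)` and `z'' = 1 - 1 / z`, an orbit of the order-three map `z ↦
1 / (1 - z)`; the third relation of the cycle follows from these two over any commutative ring. -/
theorem mul_one_sub_of_relations {R : Type*} [CommRing R] {z z' z'' : R}
    (h : z * z' - z' + 1 = 0) (h' : z * z'' - z + 1 = 0) :
    z' * (1 - z) = 1 ∧ z'' * z = z - 1 ∧ z'' * (1 - z') = 1 ∧ z' * z'' = z'' - 1 ∧
      z * (1 - z'') = 1 ∧ z * z' = z' - 1 := by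
  have h1 : z' * (1 - z) = 1 := by linear_combination -h
  have h2 : z * (1 - z'') = 1 := by linear_combination -h'
  have h3 : z' * z'' = z'' - 1 := by
    linear_combination z'' * h1 + z' * h' + h
  refine ⟨h1, ?_, ?_, h3, h2, ?_⟩
  · linear_combination h'
  · linear_combination -h3
  · linear_combination h

-- Each gluing or eigenvalue equation is multiplied by the denominators of its dependent
-- coordinates. Products such as `z' * (1 - z)` and `z'' * z` are then replaced one after another by
-- `1` and `z - 1`.
open MvPolynomial in
theorem ShapeRelations.of_relations {R : Type*} [CommRing R] [Algebra ℚ R] {z : EdgeVar → R}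
    {e : PeriphVar → R}
    (hz : ∀ p ∈ edgeRelations ∪ faceRelations ∪ (crossRatioU ∪ crossRatioV), aeval z p = 0)
    (he : ∀ p ∈ eigenvalueRelations, aeval (Sum.elim z e) p = 0) :
    ShapeRelations (z .u12) (z .u21) (z .u34) (z .u43) (z .v14) (z .v34) (z .v43) (z .v21)
      (z .v23) (z .u23) (e .L) (e .Ls) (e .M) (e .Ms) := by
  simp only [edgeRelations, faceRelations, crossRatioU, crossRatioV, Set.mem_union,
    Set.mem_insert_iff, Set.mem_singleton_iff, or_imp, forall_and, forall_eq, map_add, map_sub,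
    map_mul, map_one, MvPolynomial.aeval_X] at hz
  simp only [eigenvalueRelations, edge, periph, Set.mem_insert_iff, Set.mem_singleton_iff, or_imp,
    forall_and, forall_eq, map_sub, map_mul, aeval_X, Sum.elim_inl, Sum.elim_inr] at he
  obtain ⟨⟨⟨E1, E2, E3, E4⟩, F1, F2, F3, F4⟩, ⟨U1, U2, U3, U4, U5, U6, U7, U8⟩,
    V1, V2, V3, V4, V5, V6, V7, V8⟩ := hz
  obtain ⟨eL, eM, eLs, eMs⟩ := he
  obtain ⟨a1, a2, -, -, a5, -⟩ := mul_one_sub_of_relations U1 U2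
  obtain ⟨b1, b2, -, -, b5, -⟩ := mul_one_sub_of_relations
    (show z .u21 * z .u24 - z .u24 + 1 = 0 from U4) U3
  obtain ⟨c1, c2, -, -, -, -⟩ := mul_one_sub_of_relations
    (show z .u34 * z .u31 - z .u31 + 1 = 0 by linear_combination U5)
    (show z .u34 * z .u32 - z .u34 + 1 = 0 by linear_combination U6)
  obtain ⟨d1, d2, -, -, d5, -⟩ := mul_one_sub_of_relations
    (show z .u43 * z .u42 - z .u42 + 1 = 0 by linear_combination U8)
    (show z .u43 * z .u41 - z .u43 + 1 = 0 by linear_combination U7)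
  obtain ⟨-, -, x3, x4, x5, -⟩ := mul_one_sub_of_relations V1 V2
  obtain ⟨B1, B2, -, -, -, -⟩ := mul_one_sub_of_relations
    (show z .v21 * z .v24 - z .v24 + 1 = 0 from V4) V3
  obtain ⟨y1, y2, -, -, y5, -⟩ := mul_one_sub_of_relations
    (show z .v34 * z .v31 - z .v31 + 1 = 0 by linear_combination V5)
    (show z .v34 * z .v32 - z .v34 + 1 = 0 by linear_combination V6)
  obtain ⟨w1, w2, -, -, w5, -⟩ := mul_one_sub_of_relations
    (show z .v43 * z .v42 - z .v42 + 1 = 0 by linear_combination V8)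
    (show z .v43 * z .v41 - z .v43 + 1 = 0 by linear_combination V7)
  have ca : z .u13 * z .u14 * z .u12 = -1 := by linear_combination z .u13 * a2 - a1
  have cc : z .u31 * z .u32 * z .u34 = -1 := by linear_combination z .u31 * c2 - c1
  have cx : z .v12 * z .v13 * z .v14 = -1 := by linear_combination z .v12 * x4 - x5
  have cB : z .v23 * z .v21 * z .v24 = -1 := by linear_combination z .v24 * B2 - B1
  have ux : IsUnit (1 - z .v14) := .of_mul_eq_one_right _ x5
  have uy : IsUnit (1 - z .v34) := .of_mul_eq_one_right _ y1
  have uw : IsUnit (1 - z .v43) := .of_mul_eq_one_right _ w1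
  refine
    { isUnit_a := .of_mul_eq_one _ a5
      isUnit_b := .of_mul_eq_one _ b5
      isUnit_d := .of_mul_eq_one _ d5
      isUnit_x := .of_mul_eq_one _ x3
      isUnit_y := .of_mul_eq_one _ y5
      isUnit_w := .of_mul_eq_one _ w5
      isUnit_a_sub := .of_mul_eq_one_right _ a1
      isUnit_B_sub := .of_mul_eq_one_right _ B1
      isUnit_c_sub := .of_mul_eq_one_right _ c1
      isUnit_d_sub := .of_mul_eq_one_right _ d1
      isUnit_x_sub := by simpa using ux.neg
      isUnit_y_sub := by simpa using uy.neg
      isUnit_w_sub := by simpa using uw.neg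
      v_mul_B := B2
      u_mul_b := b2
      eq_a := ?_
      eq_c := ?_
      eq_v := ?_
      eq_u := ?_
      eq_bB := ?_
      eq_uv := ?_
      eq_L := ?_
      eq_Ls := ?_
      eq_M := ?_
      eq_Ms := ?_ }
  · linear_combination (1 - z .u43) * E4 - (z .u12 * z .u43 * z .v14 * z .v32 * z .v34) * d1
      - (z .u12 * z .u43 * z .v14) * y2
  · linear_combination (-(z .u34 * z .v14 * z .u43 * (1 - z .v43))) * E2
      + ((z .v12 * z .v13 * z .v14) * (z .u41 * z .u43) * (z .v42 * (1 - z .v43))) * cc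
      - ((z .u41 * z .u43) * (z .v42 * (1 - z .v43))) * cx
      + (z .v42 * (1 - z .v43)) * d2 + (z .u43 - 1) * w1
  · linear_combination (z .u34 * (1 - z .u43) * z .v14) * F2 - (z .u12 * z .v43 * z .v23) *
      ((z .u42 * (1 - z .u43)) * (z .v13 * z .v14) * c2
        + (z .u34 - 1) * (z .v13 * z .v14) * d1 + (z .u34 - 1) * x4)
  · linear_combination ((1 - z .u12) * (1 - z .v14) * z .v34 * (1 - z .v43)) * F3
      - (z .u23 * z .u43) *
        ((z .v12 * (1 - z .v14)) * (z .v32 * z .v34) * (z .v42 * (1 - z .v43)) * a1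
        + (z .v32 * z .v34) * (z .v42 * (1 - z .v43)) * x5
        + (z .v42 * (1 - z .v43)) * y2 + (z .v34 - 1) * w1)
  · linear_combination ((1 - z .u34) * z .u43 * (1 - z .v34) * z .v43) * F1
      - (z .u21 * z .v21) *
        ((z .u41 * z .u43) * (z .v31 * (1 - z .v34)) * (z .v41 * z .v43) * c1
        + (z .v31 * (1 - z .v34)) * (z .v41 * z .v43) * d2
        + (z .u43 - 1) * (z .v41 * z .v43) * y1 + (z .u43 - 1) * w2)
  · linear_combination (z .u12 * z .v23 * (1 - z .v34)) * E1
      - z .u23 * ((z .v23 * z .v21 * z .v24) * (z .v31 * (1 - z .v34)) * ca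
        - (z .v31 * (1 - z .v34)) * cB + y1)
  · linear_combination (1 - z .v21) * eL - (z .u34 * e .L) * B1
  · linear_combination (1 - z .v43) * eLs + w1
  · linear_combination ((1 - z .v34) * (1 - z .u43) * (1 - z .v43) * (1 - z .u21) *
        (1 - z .u12) * (1 - z .u34)) * eM
      - ((1 - z .u12) * (1 - z .u34) * e .M) *
        ((z .u42 * (1 - z .u43)) * (z .v42 * (1 - z .v43)) * (z .u24 * (1 - z .u21)) * y1
        + (z .v42 * (1 - z .v43)) * (z .u24 * (1 - z .u21)) * d1
        + (z .u24 * (1 - z .u21)) * w1 + b1)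
      + (z .v14 * z .v23 * (1 - z .v34) * (1 - z .u43) * (1 - z .v43) * (1 - z .u21)) *
        ((z .u31 * (1 - z .u34)) * a1 + c1)
  · linear_combination ((1 - z .u43) * z .v34 * (1 - z .u21) * z .v43 * (1 - z .u34) * z .v14 *
        (1 - z .u12) * (1 - z .v21)) * eMs
      - ((1 - z .u34) * z .v14 * (1 - z .u12) * (1 - z .v21) * e .Ms) *
        ((z .v32 * z .v34) * (z .u24 * (1 - z .u21)) * (z .v41 * z .v43) * d1
        + (z .u24 * (1 - z .u21)) * (z .v41 * z .v43) * y2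
        + (z .v34 - 1) * (z .v41 * z .v43) * b1 + (z .v34 - 1) * w2)
      + ((1 - z .u43) * z .v34 * (1 - z .u21) * z .v43) *
        ((z .v13 * z .v14) * (z .u13 * (1 - z .u12)) * (z .v24 * (1 - z .v21)) * c1
        + (z .u13 * (1 - z .u12)) * (z .v24 * (1 - z .v21)) * x4
        + (z .v14 - 1) * (z .v24 * (1 - z .v21)) * a1 + (z .v14 - 1) * B1)

/-! ### Explicit points with prescribed `L` and `L*`. -/

section Points

variable {K : Type*} [Field K]

/-- The edge coordinates determined by the shape parameters
`a = u12`, `b = u21`, `c = u34`, `d = u43`, `x = v14`, `y = v34`, `w = v43`, `B = v21`. -/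
def edgeCoords (a b c d x y w B : K) : EdgeVar → K
  | .u12 => a | .u13 => 1 / (1 - a) | .u14 => (a - 1) / a
  | .u21 => b | .u24 => 1 / (1 - b) | .u23 => (b - 1) / b
  | .u34 => c | .u31 => 1 / (1 - c) | .u32 => (c - 1) / c
  | .u43 => d | .u42 => 1 / (1 - d) | .u41 => (d - 1) / d
  | .v12 => 1 / (1 - x) | .v13 => (x - 1) / x | .v14 => x
  | .v21 => B | .v24 => 1 / (1 - B) | .v23 => (B - 1) / B
  | .v34 => y | .v31 => 1 / (1 - y) | .v32 => (y - 1) / y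
  | .v43 => w | .v42 => 1 / (1 - w) | .v41 => (w - 1) / w

open MvPolynomial in
theorem aeval_edgeCoords_eq_zero [Algebra ℚ K] {a b c d x y w B : K}
    (ha : a ≠ 0) (hb : b ≠ 0) (hc : c ≠ 0) (hd : d ≠ 0) (hx : x ≠ 0) (hy : y ≠ 0) (hw : w ≠ 0)
    (hB : B ≠ 0) (ha1 : 1 - a ≠ 0) (hb1 : 1 - b ≠ 0) (hc1 : 1 - c ≠ 0) (hd1 : 1 - d ≠ 0)
    (hx1 : 1 - x ≠ 0) (hy1 : 1 - y ≠ 0) (hw1 : 1 - w ≠ 0) (hB1 : 1 - B ≠ 0)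
    (E1 : (b - 1) * B = a * b * (B - 1) * (1 - y))
    (E2 : c * d * x * (1 - w) = d - 1)
    (E3 : b * c * (B - 1) * (w - 1) = (1 - b) * B)
    (E4 : a * d * x * (y - 1) = 1 - d)
    (F1 : b * B * (d - 1) * (w - 1) = (1 - c) * d * (1 - y) * w)
    (F2 : a * (c - 1) * (x - 1) * (B - 1) * w = B * c * (1 - d) * x)
    (F3 : (b - 1) * d * (y - 1) = b * (1 - a) * (1 - x) * y * (1 - w))
    (F4 : (a - 1) * c * x * y = a * (1 - b) * (1 - B)) :
    ∀ p ∈ edgeRelations ∪ faceRelations ∪ (crossRatioU ∪ crossRatioV),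
      aeval (edgeCoords a b c d x y w B) p = 0 := by
  simp only [edgeRelations, faceRelations, crossRatioU, crossRatioV, Set.mem_union,
    Set.mem_insert_iff, Set.mem_singleton_iff, or_imp, forall_and, forall_eq, map_add, map_sub,
    map_mul, map_one, MvPolynomial.aeval_X, edgeCoords]
  refine ⟨⟨⟨?_, ?_, ?_, ?_⟩, ?_, ?_, ?_, ?_⟩, ⟨?_, ?_, ?_, ?_, ?_, ?_, ?_, ?_⟩,
    ?_, ?_, ?_, ?_, ?_, ?_, ?_, ?_⟩
  all_goals field_simp
  all_goals try ring1
  · linear_combination (a - 1) * E1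
  · linear_combination (-(1 - c) * (1 - x)) * E2
  · linear_combination E3
  · linear_combination E4
  · linear_combination F1
  · linear_combination F2
  · linear_combination F3
  · linear_combination F4

open MvPolynomial in
theorem exists_periph_of_edgeCoords [Algebra ℚ K] {a b c d x y w B L Ls : K}
    (hw : w ≠ 0) (hy : y ≠ 0) (hb1 : 1 - b ≠ 0)
    (hd1 : 1 - d ≠ 0) (hy1 : 1 - y ≠ 0) (hw1 : 1 - w ≠ 0) (hB1 : 1 - B ≠ 0)
    (hL : c * L = a * b * (1 - B)) (hLs : c * Ls * (1 - w) = 1) :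
    ∃ e : PeriphVar → K, e .L = L ∧ e .Ls = Ls ∧
      ∀ p ∈ eigenvalueRelations, aeval (Sum.elim (edgeCoords a b c d x y w B) e) p = 0 := by
  let z := edgeCoords a b c d x y w B
  refine ⟨fun
    | .L => L
    | .Ls => Ls
    | .M => (z .u13 * z .u31 * z .v14 * z .v23) / (z .v31 * z .u42 * z .v42 * z .u24)
    | .Ms => (z .u31 * z .v13 * z .u13 * z .v24) / (z .u42 * z .v32 * z .u24 * z .v41),
    rfl, rfl, ?_⟩
  have hy1' : y - 1 ≠ 0 := fun h => hy1 (by linear_combination -h)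
  have hw1' : w - 1 ≠ 0 := fun h => hw1 (by linear_combination -h)
  simp only [eigenvalueRelations, edge, periph, Set.mem_insert_iff, Set.mem_singleton_iff, or_imp,
    forall_and, forall_eq, map_sub, map_mul, aeval_X, Sum.elim_inl, Sum.elim_inr]
  refine ⟨?_, ?_, ?_, ?_⟩
  · simp only [edgeCoords]
    field_simp
    linear_combination hL
  · rw [mul_div_cancel₀, sub_self]
    simp [edgeCoords, hy1, hd1, hw1, hb1]
  · simp only [edgeCoords]
    field_simp
    linear_combination hLs
  · rw [mul_div_cancel₀, sub_self]
    simp [edgeCoords, hy1', hd1, hw1', hb1, hy, hw]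

/-- The relation between the eigenvalues `l = L`, `k = L*` and a third parameter `t`, on the second
component. -/
def eigenvalueRelation2 (l k t : K) : K :=
  (k - t) * (1 - t) * l ^ 2 + (t * k * (k - t) + (k * t - t + 1)) * l + t * k * (t * k - k + 1)

/-- The relation between the eigenvalues `l = L`, `k = L*` and a third parameter `t`, on the third
component. -/
def eigenvalueRelation3 (l k t : K) : K :=
  (t - k) * (t - 1) * l ^ 2 + (k ^ 2 * t * (t - 1) + k * t - k + t) * l + k * (k * t - t + 1)

/-- The computation of `L_sq_eq` run backwards, with the same quadratic form. -/
theorem H2_eq_zero {x y w d t L : K} (hx : x ≠ 0) (ht : t * w = x * (w - 1))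
    (hP : P2 x d w = 0) (hL : (w - 1) * (x - 1) * L = x * d * (y - 1))
    (hL2 : L ^ 2 = x * y * (L + w * (t - 1))) : H2 x y w = 0 := by
  have hp : x * ((x ^ 2 * (w - 1) ^ 2 - x * w * (w - 1) + w) * (y - 1)) =
      w * (x - 1) * (w - 1) * L := by
    rw [P2] at hP
    linear_combination (-w) * hL - (x * (y - 1)) * hP
  have hH' : H2 x y w = x * ((x ^ 2 * (w - 1) ^ 2 - x * w * (w - 1) + w) * (y - 1)) ^ 2
      - x * y * ((x ^ 2 * (w - 1) ^ 2 - x * w * (w - 1) + w) * (y - 1)) *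
        (w * (x - 1) * (w - 1))
      - y * (x * (w - 1) - w) * (w * (x - 1) * (w - 1)) ^ 2 := by
    rw [H2]; ring
  refine mul_left_cancel₀ hx ?_
  rw [hH']
  linear_combination
    (x * ((x ^ 2 * (w - 1) ^ 2 - x * w * (w - 1) + w) * (y - 1)) + w * (x - 1) * (w - 1) * L
      - x * y * (w * (x - 1) * (w - 1))) * hp
    + (w * (x - 1) * (w - 1)) ^ 2 * (x * y * ht + hL2)

theorem H3_eq_zero {x y w L : K} (hx : x ≠ 0) (hL0 : L ≠ 0)
    (hL : x * y * (x - 1) * (w - 1) * L = x * y - 1)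
    (hL2 : L * (x * y * (x * y - x) - (x * y - 1)) *
        ((x * y - x) * (x * y - 1) * L + x * y * (1 - x)) +
      x * (x * y - 1) ^ 2 * ((x * y - 1) * L + 1) = 0) : H3 x y w = 0 := by
  have hL' : x * y * (x - 1) * w * L = x * y - 1 + x * y * (x - 1) * L := by
    linear_combination hL
  have hH' : x * H3 x y w = x * (x * y - 1) * (x * y * (x - 1) * w) ^ 2
      + (x * (x * y - 1) ^ 3
          - x * y * (x - 1) * ((x * y) ^ 2 - x * y + 1 - 2 * x + x * (x * y)))
        * (x * y * (x - 1) * w)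
      + (x * y * (x * y - x) - (x * y - 1)) ^ 2 * (x * y - x) := by
    rw [H3]; ring
  refine mul_left_cancel₀ hx (mul_left_cancel₀ (pow_ne_zero 2 hL0) ?_)
  rw [hH']
  linear_combination (x * y - 1) * hL2
    + (x * (x * y - 1) * (x * y * (x - 1) * w * L + x * y - 1 + x * y * (x - 1) * L)
      + (x * (x * y - 1) ^ 3
          - x * y * (x - 1) * ((x * y) ^ 2 - x * y + 1 - 2 * x + x * (x * y))) * L) * hL'

-- Solves the relations of the second component for the shape parameters in terms of `L`, `k` and
-- `t`. The only surviving condition is `L_sq_eq`, which becomes the quadratic `hΦ`; the other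
-- hypotheses keep numerators and denominators nonzero.
open MvPolynomial in
theorem exists_point_on_second_component [Algebra ℚ K] {L k t : K} (hk : k ≠ 0) (ht : t ≠ 0)
    (ht1 : t - 1 ≠ 0) (hkt : k - t ≠ 0) (hm : t ^ 2 - t + 1 ≠ 0) (hn : k * t - t + 1 ≠ 0)
    (hc : t * k - k + 1 ≠ 0) (hΦ : eigenvalueRelation2 L k t = 0) :
    ∃ (z : EdgeVar → K) (e : PeriphVar → K), e .L = L ∧ e .Ls = k ∧
      (∀ p ∈ edgeRelations ∪ faceRelations ∪ (crossRatioU ∪ crossRatioV), aeval z p = 0) ∧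
      P2 (z .v14) (z .u43) (z .v43) = 0 ∧ H2 (z .v14) (z .v34) (z .v43) = 0 ∧
      ∀ p ∈ eigenvalueRelations, aeval (Sum.elim z e) p = 0 := by
  rw [eigenvalueRelation2] at hΦ
  have hL : L ≠ 0 := by
    rintro rfl
    have : t * k * (t * k - k + 1) = 0 := by linear_combination hΦ
    simp_all
  obtain ⟨m, hm'⟩ : ∃ m, m = t ^ 2 - t + 1 := ⟨_, rfl⟩
  obtain ⟨n, hn'⟩ : ∃ n, n = k * t - t + 1 := ⟨_, rfl⟩
  obtain ⟨c, hc'⟩ : ∃ c, c = t * k - k + 1 := ⟨_, rfl⟩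
  obtain ⟨j, hj'⟩ : ∃ j, j = k - t := ⟨_, rfl⟩
  obtain ⟨s, hs'⟩ : ∃ s, s = t - 1 := ⟨_, rfl⟩
  obtain ⟨q₁, hq₁⟩ : ∃ q, q = t * c * k + L * n := ⟨_, rfl⟩
  obtain ⟨q₂, hq₂⟩ : ∃ q, q = L * j + c := ⟨_, rfl⟩
  obtain ⟨q₃, hq₃⟩ : ∃ q, q = n - L * s * j := ⟨_, rfl⟩
  obtain ⟨q₄, hq₄⟩ : ∃ q, q = n * L + c * t := ⟨_, rfl⟩
  -- `R1`, `R2` and `R3` are rearrangements of `hΦ` (the first after multiplication by `c`). They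
  -- show that no `qᵢ` vanishes and later verify the gluing equations.
  have R1 : q₁ * q₂ = k * L ^ 2 * m * j := by
    subst hq₁ hq₂ hm' hn' hc' hj'
    linear_combination (t * k - k + 1) * hΦ
  have R2 : L * q₃ = -(t * k * q₂) := by
    subst hq₃ hq₂ hm' hn' hc' hj' hs'
    linear_combination hΦ
  have R3 : k * q₄ = s * L * q₂ := by
    subst hq₄ hq₂ hm' hn' hc' hj' hs'
    linear_combination hΦ
  have R4 : q₁ * q₃ = -(k ^ 2 * L * m * j * t) := by
    refine mul_left_cancel₀ hL ?_
    linear_combination q₁ * R2 - (t * k) * R1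
  rw [← hm'] at hm
  rw [← hn'] at hn
  rw [← hc'] at hc
  rw [← hj'] at hkt
  rw [← hs'] at ht1
  have h12 : q₁ * q₂ ≠ 0 := by
    rw [R1]; exact mul_ne_zero (mul_ne_zero (mul_ne_zero hk (pow_ne_zero 2 hL)) hm) hkt
  have h1 : q₁ ≠ 0 := left_ne_zero_of_mul h12
  have h2 : q₂ ≠ 0 := right_ne_zero_of_mul h12
  have h3 : q₃ ≠ 0 := by
    refine right_ne_zero_of_mul (a := L) ?_
    rw [R2]; exact neg_ne_zero.2 (mul_ne_zero (mul_ne_zero ht hk) h2)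
  have h4 : q₄ ≠ 0 := by
    refine right_ne_zero_of_mul (a := k) ?_
    rw [R3]; exact mul_ne_zero (mul_ne_zero ht1 hL) h2
  -- Eliminating `d` from `(w - 1) * (t - 1) * k = d` and `d - 1 = w * t * (t - 1)` gives `w`, hence
  -- `d`. Then `x` comes from `t * w = x * (w - 1)`, `C` from `C * d = 1 - t`, `y` from `mul_L_eq`,
  -- and `a` from `eq_a`.
  obtain ⟨x, hx⟩ : ∃ x, x = t * c / m := ⟨_, rfl⟩
  obtain ⟨y, hy⟩ : ∃ y, y = q₁ / (t * c * k) := ⟨_, rfl⟩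
  obtain ⟨w, hw⟩ : ∃ w, w = c / (s * j) := ⟨_, rfl⟩
  obtain ⟨d, hd⟩ : ∃ d, d = k * m / j := ⟨_, rfl⟩
  obtain ⟨a, ha⟩ : ∃ a, a = -(c * t) / (n * L) := ⟨_, rfl⟩
  obtain ⟨C, hC⟩ : ∃ C, C = -(s * j) / (k * m) := ⟨_, rfl⟩
  obtain ⟨b, hb⟩ : ∃ b, b = n * q₂ / (m * c) := ⟨_, rfl⟩
  obtain ⟨B, hB⟩ : ∃ B, B = n / q₃ := ⟨_, rfl⟩
  have hx1 : 1 - x = -(s * n) / m := by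
    rw [hx]; field_simp; subst hm' hn' hc' hs'; ring
  have hy1 : 1 - y = -(L * n) / (t * c * k) := by
    rw [hy]; field_simp; subst hq₁; ring
  have hw1 : 1 - w = -m / (s * j) := by
    rw [hw]; field_simp; subst hm' hc' hs' hj'; ring
  have hd1 : 1 - d = -(t * c) / j := by
    rw [hd]; field_simp; subst hm' hc' hj'; ring
  have ha1 : 1 - a = q₄ / (n * L) := by
    rw [ha]; field_simp; subst hq₄; ring
  have hC1 : 1 - C = t * n / (k * m) := by
    rw [hC]; field_simp; subst hm' hn' hs' hj'; ring
  have hb1 : 1 - b = -(j * q₄) / (m * c) := by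
    rw [hb]; field_simp; subst hq₄ hq₂ hm' hn' hc' hj'; ring
  have hB1 : 1 - B = -(L * s * j) / q₃ := by
    rw [hB]; field_simp; subst hq₃; ring
  have hx1' : x - 1 = s * n / m := by rw [← neg_sub, hx1]; ring
  have hy1' : y - 1 = L * n / (t * c * k) := by rw [← neg_sub, hy1]; ring
  have hw1' : w - 1 = m / (s * j) := by rw [← neg_sub, hw1]; ring
  have hd1' : d - 1 = t * c / j := by rw [← neg_sub, hd1]; ring
  have ha1' : a - 1 = -q₄ / (n * L) := by rw [← neg_sub, ha1]; ring
  have hC1' : C - 1 = -(t * n) / (k * m) := by rw [← neg_sub, hC1]; ring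
  have hb1' : b - 1 = j * q₄ / (m * c) := by rw [← neg_sub, hb1]; ring
  have hB1' : B - 1 = L * s * j / q₃ := by rw [← neg_sub, hB1]; ring
  have hx0 : x ≠ 0 := by rw [hx]; positivity
  have hy0 : y ≠ 0 := by rw [hy]; positivity
  have hw0 : w ≠ 0 := by rw [hw]; positivity
  have hd0 : d ≠ 0 := by rw [hd]; positivity
  have ha0 : a ≠ 0 := by rw [ha, neg_div]; exact neg_ne_zero.2 (by positivity)
  have hC0 : C ≠ 0 := by rw [hC, neg_div]; exact neg_ne_zero.2 (by positivity)
  have hb0 : b ≠ 0 := by rw [hb]; positivity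
  have hB0 : B ≠ 0 := by rw [hB]; positivity
  have hx10 : 1 - x ≠ 0 := by rw [hx1, neg_div]; exact neg_ne_zero.2 (by positivity)
  have hy10 : 1 - y ≠ 0 := by rw [hy1, neg_div]; exact neg_ne_zero.2 (by positivity)
  have hw10 : 1 - w ≠ 0 := by rw [hw1, neg_div]; exact neg_ne_zero.2 (by positivity)
  have hd10 : 1 - d ≠ 0 := by rw [hd1, neg_div]; exact neg_ne_zero.2 (by positivity)
  have ha10 : 1 - a ≠ 0 := by rw [ha1]; positivity
  have hC10 : 1 - C ≠ 0 := by rw [hC1]; positivity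
  have hb10 : 1 - b ≠ 0 := by rw [hb1, neg_div]; exact neg_ne_zero.2 (by positivity)
  have hB10 : 1 - B ≠ 0 := by rw [hB1, neg_div]; exact neg_ne_zero.2 (by positivity)
  obtain ⟨e, heL, heLs, he⟩ := exists_periph_of_edgeCoords (a := a) (b := b) (c := C) (d := d)
    (x := x) (y := y) (w := w) (B := B) (L := L) (Ls := k) hw0 hy0 hb10 hd10 hy10 hw10 hB10
    (by rw [hC, ha, hb, hB1]; field_simp; linear_combination -R2)
    (by rw [hC, hw1]; field_simp)
  have htw : t * w = x * (w - 1) := by rw [hx, hw1', hw]; field_simp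
  have hdw : d - 1 = w * t * s := by rw [hd1', hw]; field_simp
  have hP : P2 x d w = 0 := by
    rw [P2]
    subst hs'
    linear_combination w * hdw + (t * w + x * (w - 1) - w) * htw
  refine ⟨edgeCoords a b C d x y w B, e, heL, heLs, ?_, hP, ?_, he⟩
  · refine aeval_edgeCoords_eq_zero ha0 hb0 hC0 hd0 hx0 hy0 hw0 hB0 ha10 hb10 hC10 hd10 hx10 hy10
      hw10 hB10 ?_ ?_ ?_ ?_ ?_ ?_ ?_ ?_
    · rw [hb1', hB1', hy1, hB, ha, hb]; field_simp; linear_combination R3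
    · rw [hw1, hd1', hC, hd, hx]; field_simp
    · rw [hB1', hw1', hb1, hb, hC, hB]; field_simp; linear_combination R3
    · rw [hy1', hd1, ha, hd, hx]; field_simp
    · rw [hd1', hw1', hC1, hy1, hb, hB, hd, hw]; field_simp; linear_combination R2
    · rw [hC1', hx1', hB1', hd1, ha, hw, hB, hC, hx]; field_simp
    · rw [hb1', hd, hy1', hb, ha1, hx1, hy, hw1]; field_simp; linear_combination -R1
    · rw [ha1', hC, hx, hy, ha, hb1, hB1]; field_simp; linear_combination R4
  · refine H2_eq_zero (d := d) (t := t) (L := L) hx0 htw hP ?_ ?_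
    · change (w - 1) * (x - 1) * L = x * d * (y - 1)
      rw [hw1', hx1', hy1', hx, hd]; field_simp
    · change L ^ 2 = x * y * (L + w * (t - 1))
      rw [← hs', hx, hy, hw]; field_simp; subst hq₂; linear_combination -R1

-- The analogue for the third component, with `p = x * y` as free parameter; the surviving condition
-- is `H3_relation`.
open MvPolynomial in
theorem exists_point_on_third_component [Algebra ℚ K] {L k p : K} (hk : k ≠ 0) (hp : p ≠ 0)
    (hp1 : p - 1 ≠ 0) (hkp : k - p ≠ 0) (hm : p ^ 2 - p + 1 ≠ 0) (hn : k * p - p + 1 ≠ 0)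
    (hc : p * k - k + 1 ≠ 0) (hΦ : eigenvalueRelation3 L k p = 0) :
    ∃ (z : EdgeVar → K) (e : PeriphVar → K), e .L = L ∧ e .Ls = k ∧
      (∀ q ∈ edgeRelations ∪ faceRelations ∪ (crossRatioU ∪ crossRatioV), aeval z q = 0) ∧
      Q3 (z .v14) (z .u43) (z .v34) = 0 ∧ H3 (z .v14) (z .v34) (z .v43) = 0 ∧
      ∀ q ∈ eigenvalueRelations, aeval (Sum.elim z e) q = 0 := by
  rw [eigenvalueRelation3] at hΦ
  have hL : L ≠ 0 := by
    rintro rfl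
    have : k * (k * p - p + 1) = 0 := by linear_combination hΦ
    simp_all
  obtain ⟨m, hm'⟩ : ∃ m, m = p ^ 2 - p + 1 := ⟨_, rfl⟩
  obtain ⟨n, hn'⟩ : ∃ n, n = k * p - p + 1 := ⟨_, rfl⟩
  obtain ⟨c, hc'⟩ : ∃ c, c = p * k - k + 1 := ⟨_, rfl⟩
  obtain ⟨j, hj'⟩ : ∃ j, j = k - p := ⟨_, rfl⟩
  obtain ⟨s, hs'⟩ : ∃ s, s = p - 1 := ⟨_, rfl⟩
  obtain ⟨r₁, hr₁⟩ : ∃ r, r = p * c * L + n := ⟨_, rfl⟩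
  obtain ⟨r₂, hr₂⟩ : ∃ r, r = p * c * L + k * n := ⟨_, rfl⟩
  obtain ⟨r₃, hr₃⟩ : ∃ r, r = s * j * L - p * c := ⟨_, rfl⟩
  obtain ⟨r₄, hr₄⟩ : ∃ r, r = s * L + 1 := ⟨_, rfl⟩
  -- `R1`, `R2` and `R3` are `hΦ` up to sign, written as products; hence no `rᵢ` vanishes.
  have R2 : L * r₃ = k * n * r₄ := by
    subst hr₃ hr₄ hn' hc' hj' hs'
    linear_combination -hΦ
  have R3 : k * r₁ = L * r₄ * j := by
    subst hr₁ hr₄ hn' hc' hj' hs'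
    linear_combination hΦ
  have R1 : r₂ * r₄ = k * m * L ^ 2 * s := by
    subst hr₂ hr₄ hm' hn' hc' hj' hs'
    linear_combination hΦ
  have R5 : r₂ * r₃ = k ^ 2 * n * m * L * s := by
    refine mul_left_cancel₀ hL ?_
    linear_combination r₂ * R2 + (k * n) * R1
  rw [← hm'] at hm
  rw [← hn'] at hn
  rw [← hc'] at hc
  rw [← hj'] at hkp
  rw [← hs'] at hp1
  have h24 : r₂ * r₄ ≠ 0 := by rw [R1]; positivity
  have h2 : r₂ ≠ 0 := left_ne_zero_of_mul h24
  have h4 : r₄ ≠ 0 := right_ne_zero_of_mul h24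
  have h3 : r₃ ≠ 0 := by
    refine right_ne_zero_of_mul (a := L) ?_
    rw [R2]; positivity
  have h1 : r₁ ≠ 0 := by
    refine right_ne_zero_of_mul (a := k) ?_
    rw [R3]; positivity
  -- `mul_Ls_eq` with `x * y = p` and `Ls = k` is linear in `x`. Then `Q3 = 0` gives `d`,
  -- `w_sub_one_mul_L_eq` gives `w`, and `a_mul_eq` and `c_mul_eq` give `a` and `C`.
  obtain ⟨x, hx⟩ : ∃ x, x = k * m / n := ⟨_, rfl⟩
  obtain ⟨y, hy⟩ : ∃ y, y = p * n / (k * m) := ⟨_, rfl⟩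
  obtain ⟨w, hw⟩ : ∃ w, w = r₁ / (p * c * L) := ⟨_, rfl⟩
  obtain ⟨d, hd⟩ : ∃ d, d = n / (p * j) := ⟨_, rfl⟩
  obtain ⟨a, ha⟩ : ∃ a, a = -m / (j * s) := ⟨_, rfl⟩
  obtain ⟨C, hC⟩ : ∃ C, C = -(p * c * L) / (k * n) := ⟨_, rfl⟩
  obtain ⟨b, hb⟩ : ∃ b, b = s * j * L / r₃ := ⟨_, rfl⟩
  obtain ⟨B, hB⟩ : ∃ B, B = -(s * r₁) / m := ⟨_, rfl⟩
  have hx1 : 1 - x = -(s * c) / n := by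
    rw [hx]; field_simp; subst hm' hn' hc' hs'; ring
  have hy1 : 1 - y = -(s * j) / (k * m) := by
    rw [hy]; field_simp; subst hm' hn' hj' hs'; ring
  have hw1 : 1 - w = -n / (p * c * L) := by
    rw [hw]; field_simp; subst hr₁; ring
  have hd1 : 1 - d = -m / (p * j) := by
    rw [hd]; field_simp; subst hm' hn' hj'; ring
  have ha1 : 1 - a = c / (j * s) := by
    rw [ha]; field_simp; subst hm' hc' hs' hj'; ring
  have hC1 : 1 - C = r₂ / (k * n) := by
    rw [hC]; field_simp; subst hr₂; ring
  have hb1 : 1 - b = -(p * c) / r₃ := by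
    rw [hb]; field_simp; subst hr₃; ring
  have hB1 : 1 - B = p * c * r₄ / m := by
    rw [hB]; field_simp; subst hr₁ hr₄ hm' hn' hc' hs'; ring
  have hx1' : x - 1 = s * c / n := by rw [← neg_sub, hx1]; ring
  have hy1' : y - 1 = s * j / (k * m) := by rw [← neg_sub, hy1]; ring
  have hw1' : w - 1 = n / (p * c * L) := by rw [← neg_sub, hw1]; ring
  have hd1' : d - 1 = m / (p * j) := by rw [← neg_sub, hd1]; ring
  have ha1' : a - 1 = -c / (j * s) := by rw [← neg_sub, ha1]; ring
  have hC1' : C - 1 = -r₂ / (k * n) := by rw [← neg_sub, hC1]; ring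
  have hb1' : b - 1 = p * c / r₃ := by rw [← neg_sub, hb1]; ring
  have hB1' : B - 1 = -(p * c * r₄) / m := by rw [← neg_sub, hB1]; ring
  have hx0 : x ≠ 0 := by rw [hx]; positivity
  have hy0 : y ≠ 0 := by rw [hy]; positivity
  have hw0 : w ≠ 0 := by rw [hw]; positivity
  have hd0 : d ≠ 0 := by rw [hd]; positivity
  have ha0 : a ≠ 0 := by rw [ha, neg_div]; exact neg_ne_zero.2 (by positivity)
  have hC0 : C ≠ 0 := by rw [hC, neg_div]; exact neg_ne_zero.2 (by positivity)
  have hb0 : b ≠ 0 := by rw [hb]; positivity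
  have hB0 : B ≠ 0 := by rw [hB, neg_div]; exact neg_ne_zero.2 (by positivity)
  have hx10 : 1 - x ≠ 0 := by rw [hx1, neg_div]; exact neg_ne_zero.2 (by positivity)
  have hy10 : 1 - y ≠ 0 := by rw [hy1, neg_div]; exact neg_ne_zero.2 (by positivity)
  have hw10 : 1 - w ≠ 0 := by rw [hw1, neg_div]; exact neg_ne_zero.2 (by positivity)
  have hd10 : 1 - d ≠ 0 := by rw [hd1, neg_div]; exact neg_ne_zero.2 (by positivity)
  have ha10 : 1 - a ≠ 0 := by rw [ha1]; positivity
  have hC10 : 1 - C ≠ 0 := by rw [hC1]; positivity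
  have hb10 : 1 - b ≠ 0 := by rw [hb1, neg_div]; exact neg_ne_zero.2 (by positivity)
  have hB10 : 1 - B ≠ 0 := by rw [hB1]; positivity
  obtain ⟨e, heL, heLs, he⟩ := exists_periph_of_edgeCoords (a := a) (b := b) (c := C) (d := d)
    (x := x) (y := y) (w := w) (B := B) (L := L) (Ls := k) hw0 hy0 hb10 hd10 hy10 hw10 hB10
    (by rw [hB1, hC, ha, hb]; field_simp; linear_combination -R2)
    (by rw [hw1, hC]; field_simp)
  have hxy : x * y = p := by rw [hx, hy]; field_simp
  have hpx : p - x = s * j / n := by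
    rw [hx]; field_simp; subst hm' hn' hj' hs'; ring
  have hpr : p * (p - x) - (p - 1) = -(s * m) / n := by
    rw [hpx, ← hs']; field_simp; subst hm' hn' hj' hs'; ring
  refine ⟨edgeCoords a b C d x y w B, e, heL, heLs, ?_, ?_, ?_, he⟩
  · refine aeval_edgeCoords_eq_zero ha0 hb0 hC0 hd0 hx0 hy0 hw0 hB0 ha10 hb10 hC10 hd10 hx10 hy10
      hw10 hB10 ?_ ?_ ?_ ?_ ?_ ?_ ?_ ?_
    · rw [hb1', hB1', hy1, hB, ha, hb]; field_simp; linear_combination -R3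
    · rw [hw1, hd1', hC, hd, hx]; field_simp
    · rw [hB1', hw1', hb1, hb, hC, hB]; field_simp; linear_combination -R3
    · rw [hy1', hd1, ha, hd, hx]; field_simp
    · rw [hd1', hw1', hC1, hy1, hb, hB, hd, hw]; field_simp; linear_combination R5
    · rw [hC1', hx1', hB1', hd1, ha, hw, hB, hC, hx]; field_simp; linear_combination -R1
    · rw [hb1', hy1', ha1, hx1, hw1, hd, hb, hy]; field_simp
    · rw [ha1', hb1, hB1, hC, hx, hy, ha]; field_simp; linear_combination R2
  · change Q3 x d y = 0
    have : Q3 x d y = x * y * (x * (y - 1)) * d - x * y + 1 := by rw [Q3]; ring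
    rw [this, hxy, hy1', hx, hd]
    field_simp
    subst hs'
    ring
  · refine H3_eq_zero (L := L) hx0 hL ?_ ?_
    · change x * y * (x - 1) * (w - 1) * L = x * y - 1
      rw [hxy, hx1', hw1', ← hs']; field_simp
    · change L * (x * y * (x * y - x) - (x * y - 1)) *
        ((x * y - x) * (x * y - 1) * L + x * y * (1 - x)) +
        x * (x * y - 1) ^ 2 * ((x * y - 1) * L + 1) = 0
      rw [hxy, hpr, hpx, hx1, hx, ← hs', ← hr₄]
      field_simp
      subst hr₃
      linear_combination -(s ^ 2 * m) * R2

end Points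

/-! ### Points in `ℚ`-algebras and membership in the elimination ideals. -/

theorem map_P2 {R S : Type*} [CommRing R] [CommRing S] (f : R →+* S) (x d w : R) :
    f (P2 x d w) = P2 (f x) (f d) (f w) := by
  simp only [P2, map_add, map_sub, map_mul, map_pow, map_neg, map_ofNat]

theorem map_H2 {R S : Type*} [CommRing R] [CommRing S] (f : R →+* S) (x y w : R) :
    f (H2 x y w) = H2 (f x) (f y) (f w) := by
  simp only [H2, map_add, map_sub, map_mul, map_pow, map_ofNat]

theorem map_Q3 {R S : Type*} [CommRing R] [CommRing S] (f : R →+* S) (x d y : R) :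
    f (Q3 x d y) = Q3 (f x) (f d) (f y) := by
  simp only [Q3, map_add, map_sub, map_mul, map_pow, map_one]

theorem map_H3 {R S : Type*} [CommRing R] [CommRing S] (f : R →+* S) (x y w : R) :
    f (H3 x y w) = H3 (f x) (f y) (f w) := by
  simp only [H3, map_add, map_sub, map_mul, map_pow, map_one, map_ofNat]

section Forward

open MvPolynomial

variable {R : Type*} [CommRing R] [Algebra ℚ R] {z : EdgeVar → R} {e : PeriphVar → R}

theorem pow_three_eq_of_second_component
    (hz : ∀ p ∈ edgeRelations ∪ faceRelations ∪ (crossRatioU ∪ crossRatioV), aeval z p = 0)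
    (he : ∀ p ∈ eigenvalueRelations, aeval (Sum.elim z e) p = 0)
    (hP : P2 (z .v14) (z .u43) (z .v43) = 0) (hH : H2 (z .v14) (z .v34) (z .v43) = 0) :
    e .L ^ 3 = e .M ∧ e .Ls ^ 3 = e .Ms := by
  have h := ShapeRelations.of_relations hz he
  have hv : aeval z (X .v41 * X .v43 - X .v43 + 1 : MvPolynomial EdgeVar ℚ) = 0 :=
    hz _ (by simp [crossRatioV])
  simp only [map_add, map_sub, map_mul, map_one, aeval_X] at hv
  -- The parameter `t` of the second component is `v14 * v41`.
  have ht : z .v14 * z .v41 * z .v43 = z .v14 * (z .v43 - 1) := by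
    linear_combination z .v14 * hv
  exact ⟨h.L_pow_three_eq_M ht hP hH, h.Ls_pow_three_eq_Ms ht hP hH⟩

theorem pow_three_mul_eq_one_of_third_component
    (hz : ∀ p ∈ edgeRelations ∪ faceRelations ∪ (crossRatioU ∪ crossRatioV), aeval z p = 0)
    (he : ∀ p ∈ eigenvalueRelations, aeval (Sum.elim z e) p = 0)
    (hQ : Q3 (z .v14) (z .u43) (z .v34) = 0) (hH : H3 (z .v14) (z .v34) (z .v43) = 0) :
    e .L ^ 3 * e .M = 1 ∧ e .Ls ^ 3 * e .Ms = 1 := by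
  have h := ShapeRelations.of_relations hz he
  exact ⟨h.L_pow_three_mul_M_eq_one hQ hH, h.Ls_pow_three_mul_Ms_eq_one hQ hH⟩

/-- A point is a zero of the ideal of the second component exactly when it satisfies the relations
that define this component. -/
theorem aeval_eq_zero_of_mem_ideal2_iff :
    (∀ p ∈ ideal2, aeval z p = 0) ↔
      (∀ p ∈ edgeRelations ∪ faceRelations ∪ (crossRatioU ∪ crossRatioV), aeval z p = 0) ∧
        P2 (z .v14) (z .u43) (z .v43) = 0 ∧ H2 (z .v14) (z .v34) (z .v43) = 0 := by
  have key : (∀ p ∈ ideal2, aeval z p = 0) ↔ ideal2 ≤ RingHom.ker (aeval (R := ℚ) z) := Iff.rfl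
  have hP := map_P2 (aeval (R := ℚ) z : MvPolynomial EdgeVar ℚ →+* R) (X .v14) (X .u43) (X .v43)
  have hH := map_H2 (aeval (R := ℚ) z : MvPolynomial EdgeVar ℚ →+* R) (X .v14) (X .v34) (X .v43)
  simp only [RingHom.coe_coe, aeval_X] at hP hH
  rw [key, ideal2, deforIdeal, sup_le_iff, Ideal.span_le, Ideal.span_le, ← hP, ← hH]
  simp only [Set.insert_subset_iff, Set.singleton_subset_iff]
  rfl

theorem aeval_eq_zero_of_mem_ideal3_iff :
    (∀ p ∈ ideal3, aeval z p = 0) ↔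
      (∀ p ∈ edgeRelations ∪ faceRelations ∪ (crossRatioU ∪ crossRatioV), aeval z p = 0) ∧
        Q3 (z .v14) (z .u43) (z .v34) = 0 ∧ H3 (z .v14) (z .v34) (z .v43) = 0 := by
  have key : (∀ p ∈ ideal3, aeval z p = 0) ↔ ideal3 ≤ RingHom.ker (aeval (R := ℚ) z) := Iff.rfl
  have hQ := map_Q3 (aeval (R := ℚ) z : MvPolynomial EdgeVar ℚ →+* R) (X .v14) (X .u43) (X .v34)
  have hH := map_H3 (aeval (R := ℚ) z : MvPolynomial EdgeVar ℚ →+* R) (X .v14) (X .v34) (X .v43)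
  simp only [RingHom.coe_coe, aeval_X] at hQ hH
  rw [key, ideal3, deforIdeal, sup_le_iff, Ideal.span_le, Ideal.span_le, ← hQ, ← hH]
  simp only [Set.insert_subset_iff, Set.singleton_subset_iff]
  rfl

theorem aeval_eq_zero_of_mem_eliminationIdeal {I : Ideal (MvPolynomial EdgeVar ℚ)}
    (hz : ∀ p ∈ I, aeval z p = 0) (he : ∀ p ∈ eigenvalueRelations, aeval (Sum.elim z e) p = 0)
    {f : MvPolynomial PeriphVar ℚ} (hf : f ∈ eliminationIdeal I) : aeval e f = 0 := by
  have hle : I.map (rename Sum.inl : MvPolynomial EdgeVar ℚ →ₐ[ℚ]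
        MvPolynomial (EdgeVar ⊕ PeriphVar) ℚ) ⊔ Ideal.span eigenvalueRelations ≤
      RingHom.ker (aeval (R := ℚ) (Sum.elim z e)) := by
    rw [sup_le_iff, Ideal.map_le_iff_le_comap, Ideal.span_le]
    refine ⟨fun p hp => ?_, he⟩
    rw [Ideal.mem_comap, RingHom.mem_ker, aeval_rename, Sum.elim_comp_inl]
    exact hz p hp
  have := hle hf
  rwa [RingHom.mem_ker, aeval_rename, Sum.elim_comp_inr] at this

/-- Test `f` at the universal point, the classes of the variables modulo the ideal. Allowing all
`ℚ`-algebras, with nilpotents, is what gives the ideal rather than its radical. -/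
theorem mem_eliminationIdeal_of_forall {I : Ideal (MvPolynomial EdgeVar ℚ)}
    {f : MvPolynomial PeriphVar ℚ}
    (h : ∀ (A : Type) [CommRing A] [Algebra ℚ A] (z : EdgeVar → A) (e : PeriphVar → A),
      (∀ p ∈ I, aeval z p = 0) → (∀ p ∈ eigenvalueRelations, aeval (Sum.elim z e) p = 0) →
        aeval e f = 0) :
    f ∈ eliminationIdeal I := by
  rw [eliminationIdeal, Ideal.mem_comap]
  set J := I.map (rename Sum.inl : MvPolynomial EdgeVar ℚ →ₐ[ℚ]
        MvPolynomial (EdgeVar ⊕ PeriphVar) ℚ) ⊔ Ideal.span eigenvalueRelations with hJ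
  have hmk : ∀ p, aeval (R := ℚ) (fun i => Ideal.Quotient.mkₐ ℚ J (X i)) p =
      Ideal.Quotient.mkₐ ℚ J p := fun p => by
    rw [← comp_aeval_apply, aeval_X_left_apply]
  have hinl : ∀ p, aeval (R := ℚ) (fun i => Ideal.Quotient.mkₐ ℚ J (X (Sum.inl i))) p =
      Ideal.Quotient.mkₐ ℚ J (rename Sum.inl p) := fun p => by
    rw [← hmk, aeval_rename]; rfl
  have hinr : ∀ p, aeval (R := ℚ) (fun i => Ideal.Quotient.mkₐ ℚ J (X (Sum.inr i))) p =
      Ideal.Quotient.mkₐ ℚ J (rename Sum.inr p) := fun p => by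
    rw [← hmk, aeval_rename]; rfl
  have := h _ (fun i => Ideal.Quotient.mkₐ ℚ J (X (Sum.inl i)))
    (fun i => Ideal.Quotient.mkₐ ℚ J (X (Sum.inr i))) (fun p hp => ?_) (fun p hp => ?_)
  · rw [hinr] at this
    exact Ideal.Quotient.eq_zero_iff_mem.1 this
  · rw [hinl]
    exact Ideal.Quotient.eq_zero_iff_mem.2 (Ideal.mem_sup_left (Ideal.mem_map_of_mem _ hp))
  · have hs : Sum.elim (fun i => Ideal.Quotient.mkₐ ℚ J (X (Sum.inl i)))
        (fun i => Ideal.Quotient.mkₐ ℚ J (X (Sum.inr i))) =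
        fun i => Ideal.Quotient.mkₐ ℚ J (X i) := by
      funext i; cases i <;> rfl
    rw [hs, hmk]
    exact Ideal.Quotient.eq_zero_iff_mem.2 (Ideal.mem_sup_right (Ideal.subset_span hp))

theorem span_le_eliminationIdeal_ideal2 :
    Ideal.span {X .L ^ 3 - X .M, X .Ls ^ 3 - X .Ms} ≤ eliminationIdeal ideal2 := by
  rw [Ideal.span_le, Set.insert_subset_iff, Set.singleton_subset_iff]
  constructor <;> refine mem_eliminationIdeal_of_forall fun A _ _ z e hz he => ?_ <;>
    obtain ⟨h, hP, hH⟩ := aeval_eq_zero_of_mem_ideal2_iff.1 hz <;>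
    simp [pow_three_eq_of_second_component h he hP hH]

theorem span_le_eliminationIdeal_ideal3 :
    Ideal.span {X .L ^ 3 * X .M - 1, X .Ls ^ 3 * X .Ms - 1} ≤ eliminationIdeal ideal3 := by
  rw [Ideal.span_le, Set.insert_subset_iff, Set.singleton_subset_iff]
  constructor <;> refine mem_eliminationIdeal_of_forall fun A _ _ z e hz he => ?_ <;>
    obtain ⟨h, hQ, hH⟩ := aeval_eq_zero_of_mem_ideal3_iff.1 hz <;>
    simp [pow_three_mul_eq_one_of_third_component h he hQ hH]

theorem aeval_eigenvalue_eq_zero {z : EdgeVar → ℂ} (hz : z ∈ Defor) :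
    ∀ p ∈ eigenvalueRelations, aeval (Sum.elim z (eigenvalue z)) p = 0 := by
  simp only [eigenvalueRelations, edge, periph, Set.mem_insert_iff, Set.mem_singleton_iff, or_imp,
    forall_and, forall_eq, map_sub, map_mul, aeval_X, Sum.elim_inl, Sum.elim_inr, eigenvalue]
  have h0 := Defor_ne_zero hz
  refine ⟨?_, ?_, ?_, ?_⟩ <;> rw [mul_div_cancel₀, sub_self] <;> simp [h0]

theorem mem_Defor_of_mem_zeroLocus {I : Ideal (MvPolynomial EdgeVar ℚ)} (hI : deforIdeal ≤ I)
    {z : EdgeVar → ℂ} (hz : z ∈ zeroLocus ℂ I) : z ∈ Defor :=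
  fun p hp => hz p (hI hp)

end Forward

/-! ### Transcendental parameters and algebraic independence. -/

section Transcendence

open Polynomial

theorem aeval_ne_zero_of_eval_ne_zero {F K : Type*} [Field F] [Field K] [Algebra F K] {t : K}
    (ht : Transcendental F t) (p : F[X]) (a : F) (h : p.eval a ≠ 0) : aeval t p ≠ 0 := by
  intro h0
  have := transcendental_iff.1 ht p h0
  simp [this] at h

theorem exists_isAlgClosed_transcendental (F : Type) [Field F] :
    ∃ (K : Type) (_ : Field K) (_ : Algebra F K) (_ : IsAlgClosed K) (t : K),
      Transcendental F t :=
  ⟨AlgebraicClosure (RatFunc F), inferInstance, inferInstance, inferInstance,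
    algebraMap (RatFunc F) _ RatFunc.X,
    (transcendental_algebraMap_iff (FaithfulSMul.algebraMap_injective _ _)).2
      RatFunc.transcendental_X⟩

/-- If `k` is transcendental over `ℚ` and `l` is transcendental over a field that contains `k`, then
a polynomial that vanishes at `(l, k)` is zero. -/
theorem eq_zero_of_eval₂_eq_zero {F K : Type*} [Field F] [Field K] [Algebra ℚ F] [Algebra F K]
    {k : F} {l : K} (hk : Transcendental ℚ k) (hl : Transcendental F l) {g : ℚ[X][X]}
    (h : g.eval₂ ((algebraMap F K).comp (aeval (R := ℚ) k : ℚ[X] →+* F)) l = 0) : g = 0 := by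
  rw [← eval₂_map] at h
  have h1 : g.map (aeval (R := ℚ) k : ℚ[X] →+* F) = 0 := transcendental_iff.1 hl _ h
  exact (Polynomial.map_eq_zero_iff (transcendental_iff_injective.1 hk)).1 h1

theorem transcendental_of_forall_ne {F K : Type*} [Field F] [IsAlgClosed F] [Field K] [Algebra F K]
    {l : K} (h : ∀ a : F, algebraMap F K a ≠ l) : Transcendental F l := by
  intro hl
  have hmin := IsAlgClosed.degree_eq_one_of_irreducible F (minpoly.irreducible hl.isIntegral)
  obtain ⟨a, ha⟩ := minpoly.mem_range_of_degree_eq_one F l hmin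
  exact h a ha

/-- The nonvanishing conditions on two parameters under which a solution of the eigenvalue relations
comes from a point of the deformation variety. -/
structure IsGenericPair {K : Type*} [Field K] (k t : K) : Prop where
  k_ne_zero : k ≠ 0
  t_ne_zero : t ≠ 0
  t_sub_one_ne_zero : t - 1 ≠ 0
  sub_ne_zero : k - t ≠ 0
  quadratic_ne_zero : t ^ 2 - t + 1 ≠ 0
  mul_sub_left_ne_zero : k * t - t + 1 ≠ 0
  mul_sub_right_ne_zero : t * k - k + 1 ≠ 0

theorem isGenericPair_of_transcendental {F K : Type*} [Field F] [Field K] [Algebra F K] {k : F}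
    {t : K} (hk : k ≠ 0) (ht : Transcendental F t) : IsGenericPair (algebraMap F K k) t where
  k_ne_zero := by simpa using hk
  t_ne_zero := by simpa using aeval_ne_zero_of_eval_ne_zero ht X 1 (by simp)
  t_sub_one_ne_zero h0 := aeval_ne_zero_of_eval_ne_zero ht (X - 1) 0 (by simp) (by
    simpa only [map_add, map_sub, map_mul, map_pow, map_one, aeval_C, aeval_X] using h0)
  sub_ne_zero h0 := aeval_ne_zero_of_eval_ne_zero ht (C k - X) 0 (by simpa using hk) (by
    simpa only [map_add, map_sub, map_mul, map_pow, map_one, aeval_C, aeval_X] using h0)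
  quadratic_ne_zero h0 := aeval_ne_zero_of_eval_ne_zero ht (X ^ 2 - X + 1) 0 (by simp) (by
    simpa only [map_add, map_sub, map_mul, map_pow, map_one, aeval_C, aeval_X] using h0)
  mul_sub_left_ne_zero h0 := aeval_ne_zero_of_eval_ne_zero ht (C k * X - X + 1) 0 (by simp) (by
    simpa only [map_add, map_sub, map_mul, map_pow, map_one, aeval_C, aeval_X] using h0)
  mul_sub_right_ne_zero h0 := aeval_ne_zero_of_eval_ne_zero ht (X * C k - C k + 1) 1 (by simp) (by
    simpa only [map_add, map_sub, map_mul, map_pow, map_one, aeval_C, aeval_X] using h0)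

theorem exists_eigenvalueRelation2_eq_zero {K : Type*} [Field K] [IsAlgClosed K] {k t : K}
    (h : IsGenericPair k t) : ∃ l, eigenvalueRelation2 l k t = 0 := by
  have ha : (k - t) * (1 - t) ≠ 0 :=
    mul_ne_zero h.sub_ne_zero (fun h0 => h.t_sub_one_ne_zero (by linear_combination -h0))
  obtain ⟨l, hl⟩ := IsAlgClosed.exists_root
    (C ((k - t) * (1 - t)) * X ^ 2 + C (t * k * (k - t) + (k * t - t + 1)) * X +
      C (t * k * (t * k - k + 1))) (by rw [degree_quadratic ha]; decide)
  refine ⟨l, ?_⟩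
  simpa [eigenvalueRelation2, IsRoot] using hl

theorem exists_eigenvalueRelation3_eq_zero {K : Type*} [Field K] [IsAlgClosed K] {k t : K}
    (h : IsGenericPair k t) : ∃ l, eigenvalueRelation3 l k t = 0 := by
  have ha : (t - k) * (t - 1) ≠ 0 :=
    mul_ne_zero (fun h0 => h.sub_ne_zero (by linear_combination -h0)) h.t_sub_one_ne_zero
  obtain ⟨l, hl⟩ := IsAlgClosed.exists_root
    (C ((t - k) * (t - 1)) * X ^ 2 + C (k ^ 2 * t * (t - 1) + k * t - k + t) * X +
      C (k * (k * t - t + 1))) (by rw [degree_quadratic ha]; decide)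
  refine ⟨l, ?_⟩
  simpa [eigenvalueRelation3, IsRoot] using hl

variable {F K : Type*} [Field F] [Field K] [Algebra F K]

/-- For `l` in `F` the relation is a polynomial in `t` over `F`. Its values at `1` and `k` vanish
only if `k * l = -1` and `l = -k ^ 2`, which forces `k ^ 3 = 1`. -/
theorem eigenvalueRelation2_algebraMap_ne_zero {k : F} {t : K} (hk : k ≠ 0)
    (hk2 : k ^ 2 - k + 1 ≠ 0) (hk3 : k ^ 3 - 1 ≠ 0) (ht : Transcendental F t) (l : F) :
    eigenvalueRelation2 (algebraMap F K l) (algebraMap F K k) t ≠ 0 := by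
  let p : F[X] := (C k - X) * (1 - X) * C l ^ 2 + (X * C k * (C k - X) + (C k * X - X + 1)) * C l +
    X * C k * (X * C k - C k + 1)
  have hp : aeval t p = eigenvalueRelation2 (algebraMap F K l) (algebraMap F K k) t := by
    simp only [p, eigenvalueRelation2, map_add, map_mul, map_sub, map_pow, map_one, aeval_C,
      aeval_X]
  rw [← hp]
  by_cases h1 : p.eval 1 = 0
  · refine aeval_ne_zero_of_eval_ne_zero ht p k fun h2 => ?_
    simp only [p, eval_add, eval_mul, eval_sub, eval_pow, eval_C, eval_X, eval_one] at h1 h2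
    have e1 : k * l + 1 = 0 := mul_left_cancel₀ hk (by linear_combination h1)
    have e2 : l + k ^ 2 = 0 := mul_left_cancel₀ hk2 (by linear_combination h2)
    exact hk3 (by linear_combination k * e2 - e1)
  · exact aeval_ne_zero_of_eval_ne_zero ht p 1 h1

/-- The same two evaluation points work, with the two conditions on `l` interchanged. -/
theorem eigenvalueRelation3_algebraMap_ne_zero {k : F} {t : K} (hk : k ≠ 0)
    (hk2 : k ^ 2 - k + 1 ≠ 0) (hk3 : k ^ 3 - 1 ≠ 0) (ht : Transcendental F t) (l : F) :
    eigenvalueRelation3 (algebraMap F K l) (algebraMap F K k) t ≠ 0 := by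
  let p : F[X] := (X - C k) * (X - 1) * C l ^ 2 +
    (C k ^ 2 * X * (X - 1) + C k * X - C k + X) * C l + C k * (C k * X - X + 1)
  have hp : aeval t p = eigenvalueRelation3 (algebraMap F K l) (algebraMap F K k) t := by
    simp only [p, eigenvalueRelation3, map_add, map_mul, map_sub, map_pow, map_one, aeval_C,
      aeval_X]
  rw [← hp]
  by_cases h1 : p.eval 1 = 0
  · refine aeval_ne_zero_of_eval_ne_zero ht p k fun h2 => ?_
    simp only [p, eval_add, eval_mul, eval_sub, eval_pow, eval_C, eval_X, eval_one] at h1 h2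
    have e1 : l + k ^ 2 = 0 := by linear_combination h1
    have e2 : k * l + 1 = 0 :=
      mul_left_cancel₀ (mul_ne_zero hk hk2) (by linear_combination h2)
    exact hk3 (by linear_combination k * e1 - e2)
  · exact aeval_ne_zero_of_eval_ne_zero ht p 1 h1

end Transcendence

/-! ### Reduction to polynomials in `L` and `L*`. -/

section Elimination

/-- The polynomials in `L` and `L*` inside the polynomials in all peripheral eigenvalues. -/
noncomputable def periphInclusion :
    Polynomial (Polynomial ℚ) →+* MvPolynomial PeriphVar ℚ :=
  Polynomial.eval₂RingHom
    (Polynomial.aeval (R := ℚ) (MvPolynomial.X PeriphVar.Ls : MvPolynomial PeriphVar ℚ) :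
      Polynomial ℚ →+* MvPolynomial PeriphVar ℚ) (MvPolynomial.X PeriphVar.L)

theorem periphInclusion_X : periphInclusion Polynomial.X = MvPolynomial.X .L := by
  simp [periphInclusion]

theorem periphInclusion_C_X :
    periphInclusion (Polynomial.C Polynomial.X) = MvPolynomial.X .Ls := by
  simp [periphInclusion]

theorem periphInclusion_C_C (a : ℚ) :
    periphInclusion (Polynomial.C (Polynomial.C a)) = MvPolynomial.C a := by
  simp [periphInclusion]

theorem aeval_periphInclusion {F K : Type*} [Field F] [Field K] [Algebra ℚ F] [Algebra ℚ K]
    [Algebra F K] {k : F} {e : PeriphVar → K} (he : e .Ls = algebraMap F K k)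
    (g : Polynomial (Polynomial ℚ)) :
    MvPolynomial.aeval e (periphInclusion g) =
      g.eval₂ ((algebraMap F K).comp (Polynomial.aeval (R := ℚ) k : Polynomial ℚ →+* F))
        (e .L) := by
  rw [periphInclusion, Polynomial.coe_eval₂RingHom]
  rw [← RingHom.coe_coe (MvPolynomial.aeval e), Polynomial.hom_eval₂]
  congr 1
  · refine Polynomial.ringHom_ext (fun a => by simp) (by simp [he])
  · simp

/-- If every peripheral variable is congruent modulo `I` to a quotient of a polynomial in `L`, `L*`
by a unit `D` modulo `I`, then an ideal over `I` that contains no polynomial in `L`, `L*` is `I`. -/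
theorem le_of_periphInclusion_mem {I J : Ideal (MvPolynomial PeriphVar ℚ)} (hIJ : I ≤ J)
    (hJ : ∀ g, periphInclusion g ∈ J → g = 0) {δ : Polynomial (Polynomial ℚ)}
    {E : MvPolynomial PeriphVar ℚ} (hE : periphInclusion δ * E - 1 ∈ I)
    (hX : ∀ i, ∃ g, periphInclusion δ * MvPolynomial.X i - periphInclusion g ∈ I) : J ≤ I := by
  -- A power of `δ` clears the denominators of any `f`, making it a polynomial in `L`, `L*` modulo
  -- `I`; since `E` inverts `δ` modulo `I`, that power can be removed at the end.
  have key : ∀ f : MvPolynomial PeriphVar ℚ, ∃ (N : ℕ) (g : Polynomial (Polynomial ℚ)),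
      periphInclusion δ ^ N * f - periphInclusion g ∈ I := by
    intro f
    induction f using MvPolynomial.induction_on with
    | C a => exact ⟨0, _, by rw [← periphInclusion_C_C, pow_zero, one_mul, sub_self]; simp⟩
    | add p q hp hq =>
      obtain ⟨N, g, hg⟩ := hp
      obtain ⟨N', g', hg'⟩ := hq
      refine ⟨N + N', δ ^ N' * g + δ ^ N * g', ?_⟩
      convert I.add_mem (I.mul_mem_left (periphInclusion δ ^ N') hg)
        (I.mul_mem_left (periphInclusion δ ^ N) hg') using 1
      simp only [map_add, map_mul, map_pow]
      ring
    | mul_X p i hp =>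
      obtain ⟨N, g, hg⟩ := hp
      obtain ⟨g', hg'⟩ := hX i
      refine ⟨N + 1, g * g', ?_⟩
      convert I.add_mem (I.mul_mem_left (periphInclusion δ * MvPolynomial.X i) hg)
        (I.mul_mem_left (periphInclusion g) hg') using 1
      simp only [map_mul]
      ring
  intro f hf
  obtain ⟨N, g, hg⟩ := key f
  have hgJ : periphInclusion g ∈ J := by
    have := J.sub_mem (J.mul_mem_left (periphInclusion δ ^ N) hf) (hIJ hg)
    rwa [sub_sub_cancel] at this
  rw [hJ g hgJ, map_zero, sub_zero] at hg
  have hg' := I.mul_mem_left (E ^ N) hg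
  rw [← Ideal.Quotient.eq_zero_iff_mem] at hg' ⊢
  rw [← Ideal.Quotient.eq_zero_iff_mem, map_sub, map_one, sub_eq_zero] at hE
  rw [← mul_assoc, ← mul_pow, mul_comm E, map_mul, map_pow, hE, one_pow, one_mul] at hg'
  exact hg'

end Elimination

/-! ### Generic points and the two elimination ideals. -/

/-- There are a field extension `K / F` with `F` algebraically closed, an element `k` of `F` and an
element `t` of `K` that are generic over `ℚ` and over `F`. -/
theorem exists_generic_pair :
    ∃ (F K : Type) (_ : Field F) (_ : Field K) (_ : Algebra ℚ F) (_ : Algebra ℚ K)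
      (_ : Algebra F K) (_ : IsAlgClosed F) (_ : IsAlgClosed K) (k : F) (t : K),
      Transcendental ℚ k ∧ Transcendental F t ∧ k ≠ 0 ∧ k ^ 2 - k + 1 ≠ 0 ∧ k ^ 3 - 1 ≠ 0 := by
  obtain ⟨F, _, _, _, k, hk⟩ := exists_isAlgClosed_transcendental ℚ
  obtain ⟨K, _, _, _, t, ht⟩ := exists_isAlgClosed_transcendental F
  refine ⟨F, K, inferInstance, inferInstance, inferInstance,
    ((algebraMap F K).comp (algebraMap ℚ F)).toAlgebra, inferInstance, inferInstance,
    inferInstance, k, t, hk, ht, fun h0 => ?_, fun h0 => ?_, fun h0 => ?_⟩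
  · exact aeval_ne_zero_of_eval_ne_zero hk Polynomial.X 1 (by simp)
      (by simpa only [Polynomial.aeval_X] using h0)
  · exact aeval_ne_zero_of_eval_ne_zero hk (Polynomial.X ^ 2 - Polynomial.X + 1) 0 (by simp)
      (by simpa only [map_add, map_sub, map_pow, map_one, Polynomial.aeval_X] using h0)
  · exact aeval_ne_zero_of_eval_ne_zero hk (Polynomial.X ^ 3 - 1) 0 (by simp)
      (by simpa only [map_sub, map_pow, map_one, Polynomial.aeval_X] using h0)

/-- Evaluate at the point built from a generic pair: its `L` is transcendental over `F`, and its
`L*` is `k`, transcendental over `ℚ`. -/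
theorem eq_zero_of_periphInclusion_mem_ideal2 (g : Polynomial (Polynomial ℚ))
    (hg : periphInclusion g ∈ eliminationIdeal ideal2) : g = 0 := by
  obtain ⟨F, K, _, _, _, _, _, _, _, k, t, hk, ht, hk0, hk2, hk3⟩ := exists_generic_pair
  have hgen := isGenericPair_of_transcendental hk0 ht
  obtain ⟨l, hl⟩ := exists_eigenvalueRelation2_eq_zero hgen
  obtain ⟨z, e, heL, heLs, hz, hP, hH, he⟩ := exists_point_on_second_component hgen.k_ne_zero
    hgen.t_ne_zero hgen.t_sub_one_ne_zero hgen.sub_ne_zero hgen.quadratic_ne_zero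
    hgen.mul_sub_left_ne_zero hgen.mul_sub_right_ne_zero hl
  have h0 := aeval_eq_zero_of_mem_eliminationIdeal
    (aeval_eq_zero_of_mem_ideal2_iff.2 ⟨hz, hP, hH⟩) he hg
  rw [aeval_periphInclusion heLs, heL] at h0
  refine eq_zero_of_eval₂_eq_zero hk (transcendental_of_forall_ne fun a ha => ?_) h0
  rw [← ha] at hl
  exact eigenvalueRelation2_algebraMap_ne_zero hk0 hk2 hk3 ht a hl

theorem eq_zero_of_periphInclusion_mem_ideal3 (g : Polynomial (Polynomial ℚ))
    (hg : periphInclusion g ∈ eliminationIdeal ideal3) : g = 0 := by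
  obtain ⟨F, K, _, _, _, _, _, _, _, k, t, hk, ht, hk0, hk2, hk3⟩ := exists_generic_pair
  have hgen := isGenericPair_of_transcendental hk0 ht
  obtain ⟨l, hl⟩ := exists_eigenvalueRelation3_eq_zero hgen
  obtain ⟨z, e, heL, heLs, hz, hQ, hH, he⟩ := exists_point_on_third_component hgen.k_ne_zero
    hgen.t_ne_zero hgen.t_sub_one_ne_zero hgen.sub_ne_zero hgen.quadratic_ne_zero
    hgen.mul_sub_left_ne_zero hgen.mul_sub_right_ne_zero hl
  have h0 := aeval_eq_zero_of_mem_eliminationIdeal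
    (aeval_eq_zero_of_mem_ideal3_iff.2 ⟨hz, hQ, hH⟩) he hg
  rw [aeval_periphInclusion heLs, heL] at h0
  refine eq_zero_of_eval₂_eq_zero hk (transcendental_of_forall_ne fun a ha => ?_) h0
  rw [← ha] at hl
  exact eigenvalueRelation3_algebraMap_ne_zero hk0 hk2 hk3 ht a hl

open MvPolynomial in
theorem eliminationIdeal_ideal2 :
    eliminationIdeal ideal2 = Ideal.span {X .L ^ 3 - X .M, X .Ls ^ 3 - X .Ms} := by
  refine le_antisymm ?_ span_le_eliminationIdeal_ideal2
  -- No denominators are needed: `M` and `Ms` are congruent to `L ^ 3` and `Ls ^ 3`.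
  refine le_of_periphInclusion_mem span_le_eliminationIdeal_ideal2
    eq_zero_of_periphInclusion_mem_ideal2 (δ := 1) (E := 1) (by simp) fun i => ?_
  cases i
  · exact ⟨Polynomial.X, by simp [periphInclusion_X]⟩
  · exact ⟨Polynomial.C Polynomial.X, by simp [periphInclusion_C_X]⟩
  · refine ⟨Polynomial.X ^ 3, ?_⟩
    rw [map_one, one_mul, map_pow, periphInclusion_X, ← neg_mem_iff, neg_sub]
    exact Ideal.subset_span (by simp)
  · refine ⟨Polynomial.C Polynomial.X ^ 3, ?_⟩
    rw [map_one, one_mul, map_pow, periphInclusion_C_X, ← neg_mem_iff, neg_sub]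
    exact Ideal.subset_span (by simp)

open MvPolynomial in
theorem eliminationIdeal_ideal3 :
    eliminationIdeal ideal3 = Ideal.span {X .L ^ 3 * X .M - 1, X .Ls ^ 3 * X .Ms - 1} := by
  refine le_antisymm ?_ span_le_eliminationIdeal_ideal3
  set I : Ideal (MvPolynomial PeriphVar ℚ) :=
    Ideal.span {X .L ^ 3 * X .M - 1, X .Ls ^ 3 * X .Ms - 1} with hI
  have hM : X .L ^ 3 * X .M - 1 ∈ I := Ideal.subset_span (by simp)
  have hMs : X .Ls ^ 3 * X .Ms - 1 ∈ I := Ideal.subset_span (by simp)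
  let x : Polynomial (Polynomial ℚ) := Polynomial.X
  let y : Polynomial (Polynomial ℚ) := Polynomial.C Polynomial.X
  have hx : periphInclusion x = X .L := periphInclusion_X
  have hy : periphInclusion y = X .Ls := periphInclusion_C_X
  -- Here `M` and `Ms` are inverses of `L ^ 3` and `Ls ^ 3`, so `L ^ 3 * Ls ^ 3` serves as common
  -- denominator, with inverse `M * Ms`.
  refine le_of_periphInclusion_mem span_le_eliminationIdeal_ideal3
    eq_zero_of_periphInclusion_mem_ideal3 (δ := x ^ 3 * y ^ 3) (E := X .M * X .Ms) ?_ fun i => ?_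
  · convert I.add_mem (I.mul_mem_left (X .Ls ^ 3 * X .Ms) hM) hMs using 1
    simp only [map_mul, map_pow, hx, hy]
    ring
  cases i
  · exact ⟨x ^ 3 * y ^ 3 * x, by simp [hx]⟩
  · exact ⟨x ^ 3 * y ^ 3 * y, by simp [hy]⟩
  · refine ⟨y ^ 3, ?_⟩
    convert I.mul_mem_left (X .Ls ^ 3) hM using 1
    simp only [map_mul, map_pow, hx, hy]
    ring
  · refine ⟨x ^ 3, ?_⟩
    convert I.mul_mem_left (X .L ^ 3) hMs using 1
    simp only [map_mul, map_pow, hx, hy]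
    ring

end FigureEight

theorem mainTheorem2 :
    (FigureEight.eliminationIdeal FigureEight.ideal2 =
        Ideal.span
          {MvPolynomial.X .L ^ 3 - MvPolynomial.X .M,
            MvPolynomial.X .Ls ^ 3 - MvPolynomial.X .Ms} ∧
      ∀ z ∈ FigureEight.D2,
        FigureEight.eigenvalue z .L ^ 3 = FigureEight.eigenvalue z .M ∧
          FigureEight.eigenvalue z .Ls ^ 3 = FigureEight.eigenvalue z .Ms) ∧
    (FigureEight.eliminationIdeal FigureEight.ideal3 =
        Ideal.span
          {MvPolynomial.X .L ^ 3 * MvPolynomial.X .M - 1,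
            MvPolynomial.X .Ls ^ 3 * MvPolynomial.X .Ms - 1} ∧
      ∀ z ∈ FigureEight.D3,
        FigureEight.eigenvalue z .L ^ 3 * FigureEight.eigenvalue z .M = 1 ∧
          FigureEight.eigenvalue z .Ls ^ 3 * FigureEight.eigenvalue z .Ms = 1) := by
  refine ⟨⟨FigureEight.eliminationIdeal_ideal2, fun z hz => ?_⟩,
    FigureEight.eliminationIdeal_ideal3, fun z hz => ?_⟩
  · obtain ⟨h, hP, hH⟩ := FigureEight.aeval_eq_zero_of_mem_ideal2_iff.1 hz
    exact FigureEight.pow_three_eq_of_second_component h (FigureEight.aeval_eigenvalue_eq_zero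
      (FigureEight.mem_Defor_of_mem_zeroLocus le_sup_left hz)) hP hH
  · obtain ⟨h, hQ, hH⟩ := FigureEight.aeval_eq_zero_of_mem_ideal3_iff.1 hz
    exact FigureEight.pow_three_mul_eq_one_of_third_component h
      (FigureEight.aeval_eigenvalue_eq_zero
        (FigureEight.mem_Defor_of_mem_zeroLocus le_sup_left hz)) hQ hH
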